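/- A *map* $G$ on a closed orientable surface is a finite connected nonempty graph (loops and multiple edges allowed) embedded in the surface so that every face is homeomorphic to an open disk; if the surface has genus $g$, then $n-m+f=2-2g$, where $n,m,f$ are the numbers of vertices, edges and faces. An *angle labeling* $\ell$ of $G$ assigns to each angle (face corner) of $G$ a label in $\mathbb{Z}_3$. A vertex or a face is of *type $k$*, for $k\ge 1$, if the labels of the angles around it, read in counterclockwise order from a suitable starting point, form $3k$ consecutive nonempty intervals such that all angles of the $j$-th interval have label $j \bmod 3$; it is of *type $0$* if all the angles around it have the same label. An edge is of *type $0$* if the four angles incident to it have the same label; it is of *type $1$* or *type $2$* if the labels of these four angles are, in clockwise (cyclic) order, $i-1,\,i,\,i,\,i+1$ for some $i\in\mathbb{Z}_3$, where the two angles labeled $i$ are at the same extremity of the edge (type $1$) or on the same side of the edge (type $2$). The labeling is EDGE if every edge is of type $0$, $1$ or $2$; it is $\mathbb{N}^*$-VERTEX (respectively $\mathbb{N}^*$-FACE) if every vertex (respectively every face) is of type $k$ for some $k\ge 1$. A graph is *$k$-connected* if it has at least $k+1$ vertices and remains connected after the removal of any $k-1$ vertices. The map $G$ is *essentially $k$-connected*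 if its lift $G^\infty=p^{-1}(G)$ to the universal cover $p$ of the surface is $k$-connected. **Theorem.** Let $G$ be a map on an orientable surface of genus $g\ge 1$. If $G$ admits an angle labeling that is EDGE, $\mathbb{N}^*$-VERTEX and $\mathbb{N}^*$-FACE, then $G$ is essentially $3$-connected. -/

import Mathlib

/-- A map on an oriented closed surface, given by its rotation system.  `D` is the type of darts
(oriented edges); `next d` is the dart that follows `d` in counterclockwise order around the vertex
from which `d` leaves, and `rev d` is the same edge with the opposite orientation.  Loops and
multiple edges are allowed. -/
structure CombinatorialMap (D : Type*) where
  next : Equiv.Perm D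
  rev : Equiv.Perm D
  rev_rev : ∀ d, rev (rev d) = d
  rev_ne : ∀ d, rev d ≠ d

/-- The cycles (orbits) of a permutation, fixed points included. -/
abbrev PermOrbit {D : Type*} (π : Equiv.Perm D) : Type _ :=
  Quotient (Equiv.Perm.SameCycle.setoid π)

/-- Reading the labels `ℓ x, ℓ (π x), ℓ (π (π x)), …` once around the cycle `c` of `π`:
type `0` means that all labels are equal; type `k ≥ 1` means that, from a suitable starting point,
the labels form `3 * k` consecutive nonempty intervals, all labels of the `j`-th interval being
`j mod 3`. -/
def HasCyclicType {D : Type*} (π : Equiv.Perm D) (ℓ : D → ZMod 3) (c : PermOrbit π) (k : ℕ) :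
    Prop :=
  if k = 0 then
    ∃ i : ZMod 3, ∀ x : D, (Quotient.mk _ x : PermOrbit π) = c → ℓ x = i
  else
    ∃ x : D, (Quotient.mk _ x : PermOrbit π) = c ∧
      ∃ len : Fin (3 * k) → ℕ, (∀ j, 0 < len j) ∧
        (List.range (Function.minimalPeriod π x)).map (fun m => ℓ ((π ^ m) x)) =
          (List.ofFn fun j : Fin (3 * k) => List.replicate (len j) ((j : ℕ) : ZMod 3)).flatten

/-- A graph is `k`-connected if it has at least `k + 1` vertices and remains connected after the
removal of any `k - 1` vertices. -/
def IsKConnected {V : Type*} (G : SimpleGraph V) (k : ℕ) : Prop :=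
  ((k + 1 : ℕ) : ℕ∞) ≤ ENat.card V ∧
    ∀ S : Finset V, S.card + 1 = k → (G.induce {v | v ∉ S}).Connected

namespace CombinatorialMap

variable {D : Type*} (M : CombinatorialMap D)

/-- The successor of `d` on the boundary walk of the face to the left of `d`.  This walk runs
counterclockwise around that face. -/
def face : Equiv.Perm D := M.next⁻¹ * M.rev

/-- The vertices of the map. -/
abbrev Vertex : Type _ := PermOrbit M.next

/-- The (unoriented) edges of the map. -/
abbrev Edge : Type _ := PermOrbit M.rev

/-- The faces of the map. -/
abbrev Face : Type _ := PermOrbit M.face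

/-- The vertex from which the dart `d` leaves. -/
def origin (d : D) : M.Vertex := Quotient.mk _ d

/-- The vertex to which the dart `d` leads. -/
def target (d : D) : M.Vertex := M.origin (M.rev d)

/-- The underlying graph of the map; loops and multiplicities do not matter for connectivity. -/
def graph : SimpleGraph M.Vertex where
  Adj u v := u ≠ v ∧ ∃ d, M.origin d = u ∧ M.target d = v
  symm := ⟨by
    rintro u v ⟨h, d, hu, hv⟩
    exact ⟨h.symm, M.rev d, hv, by rw [target, M.rev_rev]; exact hu⟩⟩
  loopless := ⟨fun _ h => h.1 rfl⟩

/-- The Euler relation `n - m + f = 2 - 2 g` of a finite connected map of genus `g`. -/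
def HasGenus (g : ℕ) : Prop :=
  (Nat.card M.Vertex : ℤ) - (Nat.card M.Edge : ℤ) + (Nat.card M.Face : ℤ) = 2 - 2 * (g : ℤ)

/-! ### Angle labelings

Every angle (face corner) lies between a dart `d` and `M.next d` for exactly one dart `d`; it is the
corner to the left of `d` at the vertex from which `d` leaves.  So an angle labeling is a function
`ℓ : D → ZMod 3`.  The angles around a vertex in counterclockwise order are `d, next d, …`, those
around a face in counterclockwise order are `d, face d, …`.  The four angles incident to the edge of
`d`, in clockwise order, are

* `d`               (at the origin of `d`, on its left side),
* `face d`          (at the target of `d`, on its left side),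
* `rev d`           (at the target of `d`, on its right side),
* `face (rev d)`    (at the origin of `d`, on its right side). -/

/-- The edge `e` has type `k`.  Type `0`: the four angles have the same label.  Types `1` and `2`:
the labels are `i - 1, i, i, i + 1` in clockwise order, the two equal ones being at the same
extremity of the edge (type `1`) or on the same side of it (type `2`). -/
def HasEdgeType (ℓ : D → ZMod 3) (e : M.Edge) (k : ℕ) : Prop :=
  ∃ d : D, (Quotient.mk _ d : M.Edge) = e ∧ ∃ i : ZMod 3,
    (k = 0 ∧ ℓ d = i ∧ ℓ (M.face d) = i ∧ ℓ (M.rev d) = i ∧ ℓ (M.face (M.rev d)) = i) ∨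
    (k = 1 ∧ ℓ d = i - 1 ∧ ℓ (M.face d) = i ∧ ℓ (M.rev d) = i ∧ ℓ (M.face (M.rev d)) = i + 1) ∨
    (k = 2 ∧ ℓ (M.face (M.rev d)) = i - 1 ∧ ℓ d = i ∧ ℓ (M.face d) = i ∧ ℓ (M.rev d) = i + 1)

/-- The labeling is `K`-EDGE: every edge has a type in `K`. -/
def IsEdgeLabeling (K : Set ℕ) (ℓ : D → ZMod 3) : Prop :=
  ∃ f : M.Edge → ℕ, (∀ e, f e ∈ K) ∧ ∀ e, M.HasEdgeType ℓ e (f e)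

/-- The labeling is `K`-VERTEX: every vertex has a type in `K`. -/
def IsVertexLabeling (K : Set ℕ) (ℓ : D → ZMod 3) : Prop :=
  ∃ f : M.Vertex → ℕ, (∀ v, f v ∈ K) ∧ ∀ v, HasCyclicType M.next ℓ v (f v)

/-- The labeling is `K`-FACE: every face has a type in `K`. -/
def IsFaceLabeling (K : Set ℕ) (ℓ : D → ZMod 3) : Prop :=
  ∃ f : M.Face → ℕ, (∀ c, f c ∈ K) ∧ ∀ c, HasCyclicType M.face ℓ c (f c)

/-! ### The universal cover

The points over the vertices are the homotopy classes of walks that start at a base vertex, where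
homotopy is generated by inserting or deleting a dart followed by its reverse and by inserting or
deleting the full boundary walk of a face.  A dart of the cover is such a class together with a dart
leaving its end vertex; rotation and reversal are lifted from the map. -/

/-- The list of darts `w` is a walk from `u` to `v`. -/
def IsWalk : M.Vertex → List D → M.Vertex → Prop
  | u, [], v => u = v
  | u, d :: w, v => M.origin d = u ∧ IsWalk (M.target d) w v

/-- The boundary walk, starting with `d`, of the face to the left of `d`. -/
noncomputable def facialWalk (d : D) : List D :=
  (List.range (Function.minimalPeriod M.face d)).map fun m => (M.face ^ m) d

/-- One elementary homotopy between walks. -/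
inductive Step : List D → List D → Prop
  | spur (u v : List D) (d : D) : Step (u ++ v) (u ++ ([d, M.rev d] ++ v))
  | facial (u v : List D) (d : D) : Step (u ++ v) (u ++ (M.facialWalk d ++ v))

/-- The walks that start at `v₀`. -/
abbrev WalkFrom (v₀ : M.Vertex) : Type _ := {w : List D // ∃ v, M.IsWalk v₀ w v}

/-- The homotopy classes (with fixed end vertices) of walks from `v₀`: the quotient by the
equivalence relation that elementary homotopies between such walks generate. -/
def HomotopyClass (v₀ : M.Vertex) : Type _ :=
  Quot fun p q : M.WalkFrom v₀ => M.Step p.1 q.1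

variable {M}

theorem isWalk_append {u v : M.Vertex} {p q : List D} :
    M.IsWalk u (p ++ q) v ↔ ∃ x, M.IsWalk u p x ∧ M.IsWalk x q v := by
  induction p generalizing u with
  | nil => simp [IsWalk]
  | cons d p ih => simp [IsWalk, ih, and_assoc]

theorem IsWalk.unique {u v v' : M.Vertex} {p : List D} (h : M.IsWalk u p v)
    (h' : M.IsWalk u p v') : v = v' := by
  induction p generalizing u with
  | nil => exact h.symm.trans h'
  | cons d p ih => exact ih h.2 h'.2

theorem IsWalk.unique_start {u u' v v' : M.Vertex} {p : List D} (hp : p ≠ [])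
    (h : M.IsWalk u p v) (h' : M.IsWalk u' p v') : u = u' := by
  cases p with
  | nil => exact absurd rfl hp
  | cons d p => exact h.1.symm.trans h'.1

theorem origin_next (d : D) : M.origin (M.next d) = M.origin d :=
  Quotient.sound (s := Equiv.Perm.SameCycle.setoid M.next)
    (Equiv.Perm.sameCycle_apply_left.mpr (Equiv.Perm.SameCycle.refl _ _))

theorem origin_face (d : D) : M.origin (M.face d) = M.target d := by
  rw [target, ← origin_next (M.face d)]
  simp [face]

theorem isWalk_face_range (d : D) (n : ℕ) :
    M.IsWalk (M.origin d) ((List.range n).map fun m => (M.face ^ m) d)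
      (M.origin ((M.face ^ n) d)) := by
  induction n with
  | zero => simp [IsWalk]
  | succ n ih =>
    rw [List.range_succ, List.map_append, isWalk_append]
    refine ⟨_, ih, rfl, ?_⟩
    rw [pow_succ', Equiv.Perm.mul_apply]
    exact (origin_face _).symm

theorem isWalk_facialWalk (d : D) :
    M.IsWalk (M.origin d) (M.facialWalk d) (M.origin d) := by
  have h := isWalk_face_range (M := M) d (Function.minimalPeriod M.face d)
  have e : (M.face ^ Function.minimalPeriod M.face d) d = d := by
    rw [← Equiv.Perm.iterate_eq_pow]
    exact Function.iterate_minimalPeriod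
  rw [e] at h
  exact h

theorem isWalk_spur (d : D) : M.IsWalk (M.origin d) [d, M.rev d] (M.origin d) :=
  ⟨rfl, rfl, by simp [IsWalk, target, M.rev_rev]⟩

/-- Inserting a closed walk does not change the end of a walk. -/
theorem IsWalk.of_insert {u v x : M.Vertex} {p q c : List D} (hc : M.IsWalk x c x)
    (h : M.IsWalk u (p ++ (c ++ q)) v) : M.IsWalk u (p ++ q) v := by
  obtain ⟨y, hp, h⟩ := isWalk_append.mp h
  obtain ⟨z, hc', hq⟩ := isWalk_append.mp h
  refine isWalk_append.mpr ⟨y, hp, ?_⟩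
  by_cases hne : c = []
  · subst hne
    rw [show y = z from hc']
    exact hq
  · have e := IsWalk.unique_start hne hc hc'
    subst e
    rwa [IsWalk.unique hc hc']

theorem Step.isWalk {u v : M.Vertex} {p q : List D} (h : M.Step p q) (hq : M.IsWalk u q v) :
    M.IsWalk u p v := by
  cases h with
  | spur a b d => exact IsWalk.of_insert (isWalk_spur d) hq
  | facial a b d => exact IsWalk.of_insert (isWalk_facialWalk d) hq

theorem Step.append {p q : List D} (h : M.Step p q) (r : List D) : M.Step (p ++ r) (q ++ r) := by
  cases h with
  | spur a b d => simpa [List.append_assoc] using Step.spur (M := M) a (b ++ r) d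
  | facial a b d => simpa [List.append_assoc] using Step.facial (M := M) a (b ++ r) d

namespace HomotopyClass

variable {v₀ : M.Vertex}

/-- The class of a walk. -/
def mk (p : M.WalkFrom v₀) : M.HomotopyClass v₀ := Quot.mk _ p

theorem mk_eq_mk {p q : M.WalkFrom v₀} (h : M.Step p.1 q.1) : mk p = mk q := Quot.sound h

theorem exists_mk (x : M.HomotopyClass v₀) : ∃ p, mk p = x := Quot.exists_rep x

/-- The common end vertex of the walks in a class. -/
noncomputable def endpoint (x : M.HomotopyClass v₀) : M.Vertex :=
  Quot.lift (fun p : M.WalkFrom v₀ => p.2.choose)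
    (fun p q h => IsWalk.unique p.2.choose_spec (Step.isWalk h q.2.choose_spec)) x

theorem endpoint_mk (p : M.WalkFrom v₀) {v : M.Vertex} (h : M.IsWalk v₀ p.1 v) :
    (mk p).endpoint = v :=
  IsWalk.unique p.2.choose_spec h

theorem isWalk_snoc (p : M.WalkFrom v₀) (d : D) (h : (mk p).endpoint = M.origin d) :
    M.IsWalk v₀ (p.1 ++ [d]) (M.target d) := by
  obtain ⟨v, hv⟩ := p.2
  rw [endpoint_mk p hv] at h
  exact isWalk_append.mpr ⟨v, hv, h.symm, rfl⟩

open Classical in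
/-- The class of `w` followed by `d`, where `w` is a walk in the class `x`.  (The value is `x` when
`d` does not leave the end vertex of `x`; this case is never used.) -/
noncomputable def snoc (x : M.HomotopyClass v₀) (d : D) : M.HomotopyClass v₀ :=
  Quot.lift
    (fun p : M.WalkFrom v₀ =>
      if h : (mk p).endpoint = M.origin d then mk ⟨p.1 ++ [d], _, isWalk_snoc p d h⟩ else mk p)
    (fun p q hpq => by
      have e : mk p = mk q := mk_eq_mk hpq
      by_cases h : (mk p).endpoint = M.origin d
      · have h2 : (mk q).endpoint = M.origin d := by rwa [← e]
        simp only [dif_pos h, dif_pos h2]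
        exact mk_eq_mk (Step.append hpq [d])
      · have h2 : ¬ (mk q).endpoint = M.origin d := by rwa [← e]
        simp only [dif_neg h, dif_neg h2]
        exact e) x

theorem snoc_mk (p : M.WalkFrom v₀) (d : D) (h : (mk p).endpoint = M.origin d) :
    (mk p).snoc d = mk ⟨p.1 ++ [d], _, isWalk_snoc p d h⟩ :=
  dif_pos h

theorem endpoint_snoc (x : M.HomotopyClass v₀) (d : D) (h : x.endpoint = M.origin d) :
    (x.snoc d).endpoint = M.target d := by
  obtain ⟨p, rfl⟩ := x.exists_mk
  rw [snoc_mk p d h]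
  exact endpoint_mk _ (isWalk_snoc p d h)

theorem snoc_snoc_rev (x : M.HomotopyClass v₀) (d : D) (h : x.endpoint = M.origin d) :
    (x.snoc d).snoc (M.rev d) = x := by
  have h2 := endpoint_snoc x d h
  obtain ⟨p, rfl⟩ := x.exists_mk
  rw [snoc_mk p d h] at h2 ⊢
  rw [snoc_mk _ (M.rev d) h2]
  refine (mk_eq_mk ?_).symm
  simpa using Step.spur (M := M) p.1 [] d

end HomotopyClass

variable (M)

/-- The darts of the universal cover. -/
abbrev CoverDart (v₀ : M.Vertex) : Type _ :=
  {p : M.HomotopyClass v₀ × D // p.1.endpoint = M.origin p.2}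

/-- The universal cover of the map, based at the vertex `v₀`. -/
noncomputable def universalCover (v₀ : M.Vertex) : CombinatorialMap (M.CoverDart v₀) where
  next :=
    { toFun := fun p => ⟨(p.1.1, M.next p.1.2), by rw [origin_next]; exact p.2⟩
      invFun := fun p => ⟨(p.1.1, M.next.symm p.1.2), by
        rw [← origin_next (M.next.symm p.1.2), Equiv.apply_symm_apply]; exact p.2⟩
      left_inv := fun p => by simp
      right_inv := fun p => by simp }
  rev :=
    Function.Involutive.toPerm
      (fun p => ⟨(p.1.1.snoc p.1.2, M.rev p.1.2), HomotopyClass.endpoint_snoc _ _ p.2⟩)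
      (fun p => Subtype.ext (Prod.ext (HomotopyClass.snoc_snoc_rev _ _ p.2) (M.rev_rev _)))
  rev_rev := fun p =>
    Subtype.ext (Prod.ext (HomotopyClass.snoc_snoc_rev _ _ p.2) (M.rev_rev _))
  rev_ne := fun p h => M.rev_ne p.1.2 (congrArg (fun q => q.1.2) h)

/-- The map is essentially `k`-connected if (the graph of) its universal cover is `k`-connected. -/
def IsEssentiallyKConnected (k : ℕ) : Prop :=
  ∀ v₀ : M.Vertex, IsKConnected (M.universalCover v₀).graph k

end CombinatorialMap

/-! Let `N` be the universal cover. It is locally finite and its first cohomology mod 2 vanishes.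
Around each vertex and each face the lifted labels rise by `0` or `1` and change at least three
times; around the four angles of an edge they change at most three times. Adding these counts over a
bounded region with connected frontier, where `E + 1 ≤ F + V` (`IsAcyclic.card_edges_lt`), gives a
discrete Gauss-Bonnet inequality (`IsAcyclic.card_vertexJumps_add_three_le`): at least three more
changes occur along frontier edges than in the angles at frontier vertices.

A straight walk always leaves through a dart where the label rises from `c - 1` to `c`, for a fixed
`c`. If the label changes along one side of an edge of the walk, it changes again in the sector that
follows on that side. So a region bounded by two straight walks has an excess of at most two, one
for each last edge, which is impossible (`IsStraight.false_of_bigon`). Hence straight walks are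
simple infinite rays, and two of them that leave a vertex by different darts meet only there.

Three such rays, one per colour, leave every vertex, so after the deletion of two vertices every
other vertex keeps an intact ray to infinity. Finally the cover has only one end: by duality, a
vertex function mod 2 with finite coboundary is constant off a finite set
(`IsAcyclic.exists_finsupp_coboundary`). The indicator of a component left by the deletion is such a
function, and rays from two components would contradict this (`isKConnected_three`). -/

open Function Finset

universe u

/-! ### Orbits of permutations -/

section Orbits

variable {α : Type*} {π : Equiv.Perm α}

theorem sameCycle_iff_exists_lt_minimalPeriod {x y : α} (hx : x ∈ periodicPts π) :
    π.SameCycle x y ↔ ∃ m < minimalPeriod π x, (π ^ m) x = y := by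
  have hpos := minimalPeriod_pos_of_mem_periodicPts hx
  constructor
  · rintro ⟨i, rfl⟩
    have hp : (π ^ (minimalPeriod π x)) x = x := by
      rw [← Equiv.Perm.iterate_eq_pow]; exact iterate_minimalPeriod
    have hpz : ∀ j : ℤ, (π ^ ((minimalPeriod π x : ℤ) * j)) x = x := by
      intro j
      rw [zpow_mul, zpow_natCast]
      exact Equiv.Perm.zpow_apply_eq_self_of_apply_eq_self hp j
    have hn : (0 : ℤ) < minimalPeriod π x := by exact_mod_cast hpos
    refine ⟨(i % (minimalPeriod π x : ℤ)).toNat, ?_, ?_⟩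
    · have := Int.emod_lt_of_pos i hn
      have := Int.emod_nonneg i hn.ne'
      omega
    · rw [← zpow_natCast, Int.toNat_of_nonneg (Int.emod_nonneg i hn.ne')]
      conv_rhs => rw [← Int.emod_add_mul_ediv i (minimalPeriod π x : ℤ), zpow_add,
        Equiv.Perm.mul_apply, hpz]
  · rintro ⟨m, -, rfl⟩
    exact ⟨m, by rw [zpow_natCast]⟩

open Classical in
/-- The orbit of a periodic point, as a finset. -/
noncomputable def orbitFinset (π : Equiv.Perm α) (x : α) : Finset α :=
  (range (minimalPeriod π x)).image fun m => (π ^ m) x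

theorem mem_orbitFinset {x y : α} (hx : x ∈ periodicPts π) :
    y ∈ orbitFinset π x ↔ π.SameCycle x y := by
  simp [orbitFinset, sameCycle_iff_exists_lt_minimalPeriod hx]

theorem sum_orbitFinset {G : Type*} [AddCommMonoid G] (x : α) (γ : α → G) :
    ∑ y ∈ orbitFinset π x, γ y = ∑ m ∈ range (minimalPeriod π x), γ ((π ^ m) x) := by
  classical
  unfold orbitFinset
  rw [sum_image]
  intro m hm n hn h
  simp only [coe_range, Set.mem_Iio] at hm hn
  simp only [← Equiv.Perm.iterate_eq_pow] at h
  exact (iterate_injOn_Iio_minimalPeriod (f := π) (x := x)) hm hn h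

/-- A function whose sum over every orbit vanishes is a difference along the orbits. -/
theorem exists_primitive_of_orbit_sum_eq_zero {G : Type*} [AddCommGroup G]
    (hπ : ∀ x, x ∈ periodicPts π) (γ : α → G)
    (h0 : ∀ x, ∑ m ∈ range (minimalPeriod π x), γ ((π ^ m) x) = 0) :
    ∃ k : α → G, ∀ x, k (π x) = k x + γ x := by
  -- A full turn contributes `0`, so the sum of `γ` along the orbit from `x` depends only on the
  -- point reached (`key3`). The primitive is this sum taken from a chosen representative of the
  -- orbit.
  have key : ∀ (x : α) (m q : ℕ), ∑ j ∈ range (minimalPeriod π x * q + m), γ ((π ^ j) x) =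
      ∑ j ∈ range m, γ ((π ^ j) x) := by
    intro x m q
    have hp : (π ^ (minimalPeriod π x)) x = x := by
      rw [← Equiv.Perm.iterate_eq_pow]; exact iterate_minimalPeriod
    induction q with
    | zero => simp
    | succ q ih =>
      rw [← ih, Nat.mul_succ, add_comm (_ * q), add_assoc, sum_range_add, h0, zero_add]
      refine sum_congr rfl fun j _ => ?_
      rw [add_comm, pow_add, Equiv.Perm.mul_apply, hp]
  have key2 : ∀ (x : α) (m n : ℕ), m ≤ n → (π ^ m) x = (π ^ n) x →
      ∑ j ∈ range m, γ ((π ^ j) x) = ∑ j ∈ range n, γ ((π ^ j) x) := by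
    intro x m n hmn h
    obtain ⟨c, rfl⟩ := Nat.exists_eq_add_of_le hmn
    rw [pow_add, Equiv.Perm.mul_apply, EmbeddingLike.apply_eq_iff_eq] at h
    have : IsPeriodicPt π c x := by
      rw [IsPeriodicPt, IsFixedPt, Equiv.Perm.iterate_eq_pow]; exact h.symm
    obtain ⟨q, rfl⟩ := this.minimalPeriod_dvd
    rw [add_comm m, key]
  have key3 : ∀ (x : α) (m n : ℕ), (π ^ m) x = (π ^ n) x →
      ∑ j ∈ range m, γ ((π ^ j) x) = ∑ j ∈ range n, γ ((π ^ j) x) := by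
    intro x m n h
    rcases le_total m n with hmn | hmn
    · exact key2 x m n hmn h
    · exact (key2 x n m hmn h.symm).symm
  let r : α → α := fun x => (Quotient.mk _ x : PermOrbit π).out
  have hr : ∀ x, π.SameCycle (r x) x := fun x =>
    Quotient.exact (s := Equiv.Perm.SameCycle.setoid π) (Quotient.out_eq _)
  have hrπ : ∀ x, r (π x) = r x := fun x => congrArg Quotient.out
    (Quotient.sound (s := Equiv.Perm.SameCycle.setoid π)
      (Equiv.Perm.sameCycle_apply_left.mpr (Equiv.Perm.SameCycle.refl _ _)))
  have hm : ∀ x, ∃ m : ℕ, (π ^ m) (r x) = x := fun x => by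
    obtain ⟨m, -, h⟩ := (sameCycle_iff_exists_lt_minimalPeriod (hπ _)).mp (hr x)
    exact ⟨m, h⟩
  choose m hm using hm
  refine ⟨fun x => ∑ j ∈ range (m x), γ ((π ^ j) (r x)), fun x => ?_⟩
  have h1 : (π ^ (m x + 1)) (r x) = (π ^ m (π x)) (r x) := by
    rw [pow_succ', Equiv.Perm.mul_apply, hm]
    conv_lhs => rw [← hm (π x), hrπ]
  simp only [hrπ]
  rw [← key3 _ _ _ h1, sum_range_succ, hm]

end Orbits

/-! ### Chains mod 2, duality and finitely supported coboundaries -/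

namespace CombinatorialMap

variable {D : Type u} (N : CombinatorialMap D)

/-- The edge of a dart. -/
def edgeOf (d : D) : N.Edge := Quotient.mk _ d

/-- The face to the left of a dart. -/
def leftFace (d : D) : N.Face := Quotient.mk _ d

variable {N}

theorem origin_eq_origin {d d' : D} : N.origin d = N.origin d' ↔ N.next.SameCycle d d' :=
  Quotient.eq (r := Equiv.Perm.SameCycle.setoid N.next)

theorem leftFace_eq_leftFace {d d' : D} : N.leftFace d = N.leftFace d' ↔ N.face.SameCycle d d' :=
  Quotient.eq (r := Equiv.Perm.SameCycle.setoid N.face)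

theorem edgeOf_eq_edgeOf {d d' : D} : N.edgeOf d = N.edgeOf d' ↔ d' = d ∨ d' = N.rev d := by
  have h : N.edgeOf d = N.edgeOf d' ↔ N.rev.SameCycle d d' :=
    Quotient.eq (r := Equiv.Perm.SameCycle.setoid N.rev)
  rw [h]
  constructor
  · rintro ⟨i, rfl⟩
    have h2 : N.rev ^ (2 : ℤ) = 1 := by
      rw [zpow_two]; ext x; exact N.rev_rev x
    rcases Int.even_or_odd' i with ⟨j, rfl | rfl⟩
    · left; rw [zpow_mul, h2]; simp
    · right; rw [zpow_add, zpow_mul, h2]; simp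
  · rintro (rfl | rfl)
    · exact Equiv.Perm.SameCycle.refl _ _
    · exact Equiv.Perm.sameCycle_apply_right.mpr (Equiv.Perm.SameCycle.refl _ _)

@[simp] theorem edgeOf_rev (d : D) : N.edgeOf (N.rev d) = N.edgeOf d :=
  (edgeOf_eq_edgeOf.mpr (Or.inr rfl)).symm

@[simp] theorem leftFace_face (d : D) : N.leftFace (N.face d) = N.leftFace d :=
  leftFace_eq_leftFace.mpr (Equiv.Perm.sameCycle_apply_left.mpr (Equiv.Perm.SameCycle.refl _ _))

theorem next_face (d : D) : N.next (N.face d) = N.rev d := by simp [face]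

theorem face_rev_next (d : D) : N.face (N.rev (N.next d)) = d := by simp [face, N.rev_rev]

theorem target_rev (d : D) : N.target (N.rev d) = N.origin d := by rw [target, N.rev_rev]

theorem exists_edgeOf (e : N.Edge) : ∃ d, N.edgeOf d = e := Quotient.exists_rep e

theorem exists_origin (v : N.Vertex) : ∃ d, N.origin d = v := Quotient.exists_rep v

theorem exists_leftFace (f : N.Face) : ∃ d, N.leftFace d = f := Quotient.exists_rep f

variable (N)

/-- First cohomology with coefficients in `ZMod 2`-modules vanishes. -/
def IsAcyclic : Prop :=
  ∀ (G : Type u) [AddCommGroup G] [Module (ZMod 2) G] (β : D → G),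
    (∀ d, β (N.rev d) = β d) →
    (∀ d, ∑ m ∈ range (minimalPeriod N.face d), β ((N.face ^ m) d) = 0) →
    ∃ h : N.Vertex → G, ∀ d, h (N.target d) = h (N.origin d) + β d

/-- Vertices and faces have finite degree. -/
structure IsLocallyFinite : Prop where
  next : ∀ d, d ∈ periodicPts N.next
  face : ∀ d, d ∈ periodicPts N.face

/-- The end vertices of an edge, as a chain. -/
noncomputable def edgeBoundary (e : N.Edge) : N.Vertex →₀ ZMod 2 :=
  Finsupp.single (N.origin e.out) 1 + Finsupp.single (N.target e.out) 1

/-- The boundary map from edge chains to vertex chains. -/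
noncomputable def boundary : (N.Edge →₀ ZMod 2) →ₗ[ZMod 2] (N.Vertex →₀ ZMod 2) :=
  Finsupp.linearCombination (ZMod 2) N.edgeBoundary

variable {N}

theorem edgeBoundary_edgeOf (d : D) : N.edgeBoundary (N.edgeOf d) =
    Finsupp.single (N.origin d) 1 + Finsupp.single (N.target d) 1 := by
  have h : N.edgeOf (N.edgeOf d).out = N.edgeOf d := Quotient.out_eq _
  rcases edgeOf_eq_edgeOf.mp h.symm with h | h
  · rw [edgeBoundary, h]
  · rw [edgeBoundary, h, target_rev, add_comm]; rfl

theorem boundary_single (d : D) : N.boundary (Finsupp.single (N.edgeOf d) 1) =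
    Finsupp.single (N.origin d) 1 + Finsupp.single (N.target d) 1 := by
  rw [boundary, Finsupp.linearCombination_single, one_smul, edgeBoundary_edgeOf]

/-- The edge chains that bound a finite chain of faces. -/
def faceBoundaries (N : CombinatorialMap D) : Submodule (ZMod 2) (N.Edge →₀ ZMod 2) where
  carrier := {z | ∃ ψ : N.Face →₀ ZMod 2,
    ∀ d, z (N.edgeOf d) = ψ (N.leftFace d) + ψ (N.leftFace (N.rev d))}
  add_mem' := by
    rintro z w ⟨ψ, hψ⟩ ⟨χ, hχ⟩
    refine ⟨ψ + χ, fun d => ?_⟩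
    rw [Finsupp.add_apply, hψ, hχ, Finsupp.add_apply, Finsupp.add_apply]; ring
  zero_mem' := ⟨0, by simp⟩
  smul_mem' := by
    rintro c z ⟨ψ, hψ⟩
    refine ⟨c • ψ, fun d => ?_⟩
    rw [Finsupp.smul_apply, hψ]; simp [mul_add]

-- The two darts of an edge are counted separately, so a loop, or an edge with the same face on both
-- sides, contributes twice, that is `0`.
open Classical in
theorem sum_orbitFinset_single_edgeOf {π : Equiv.Perm D} {d : D} (hd : d ∈ periodicPts π)
    (d' : D) : ∑ y ∈ orbitFinset π d, Finsupp.single (N.edgeOf y) (1 : ZMod 2) (N.edgeOf d') =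
      (if π.SameCycle d d' then 1 else 0) + (if π.SameCycle d (N.rev d') then 1 else 0) := by
  have : ∀ y ∈ orbitFinset π d, (Finsupp.single (N.edgeOf y) (1 : ZMod 2)) (N.edgeOf d') =
      (if y = d' then 1 else 0) + (if y = N.rev d' then 1 else 0) := by
    intro y _
    rw [Finsupp.single_apply]
    have := N.rev_ne d'
    by_cases h1 : y = d'
    · subst h1; simp [this.symm]
    · by_cases h2 : y = N.rev d'
      · subst h2; simp [this]
      · rw [if_neg, if_neg h1, if_neg h2, add_zero]
        rw [eq_comm, edgeOf_eq_edgeOf]; tauto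
  rw [sum_congr rfl this, sum_add_distrib, sum_ite_eq', sum_ite_eq']
  simp only [mem_orbitFinset hd]

theorem boundary_apply {d : D} (hd : d ∈ periodicPts N.next) (z : N.Edge →₀ ZMod 2) :
    N.boundary z (N.origin d) = ∑ y ∈ orbitFinset N.next d, z (N.edgeOf y) := by
  classical
  induction z using Finsupp.induction_linear with
  | zero => simp
  | add f g hf hg => simp [hf, hg, sum_add_distrib]
  | single e c =>
    obtain ⟨d', rfl⟩ := exists_edgeOf e
    have h1 : Finsupp.single (N.edgeOf d') c = c • Finsupp.single (N.edgeOf d') (1 : ZMod 2) := by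
      simp
    simp only [h1, map_smul, Finsupp.smul_apply, ← smul_sum]
    have h2 : ∀ y, Finsupp.single (N.edgeOf d') (1 : ZMod 2) (N.edgeOf y) =
        Finsupp.single (N.edgeOf y) 1 (N.edgeOf d') := fun y => by
      simp [Finsupp.single_apply, eq_comm]
    simp only [h2, sum_orbitFinset_single_edgeOf hd]
    simp only [boundary_single, Finsupp.add_apply, Finsupp.single_apply, target, origin_eq_origin, Equiv.Perm.sameCycle_comm (y := d)]

theorem sum_facial_mem_faceBoundaries (hf : ∀ d, d ∈ periodicPts N.face) (d : D) :
    ∑ m ∈ range (minimalPeriod N.face d), Finsupp.single (N.edgeOf ((N.face ^ m) d)) 1 ∈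
      N.faceBoundaries := by
  classical
  refine ⟨Finsupp.single (N.leftFace d) 1, fun d' => ?_⟩
  rw [← sum_orbitFinset (π := N.face) d (fun y => Finsupp.single (N.edgeOf y) (1 : ZMod 2)),
    Finsupp.finsetSum_apply, sum_orbitFinset_single_edgeOf (hf d), Finsupp.single_apply,
    Finsupp.single_apply]
  simp only [leftFace_eq_leftFace]

/-- Every edge cycle of an acyclic map bounds a finite chain of faces. -/
theorem IsAcyclic.exists_faceChain (hN : N.IsAcyclic) (hf : ∀ d, d ∈ periodicPts N.face)
    {z : N.Edge →₀ ZMod 2} (hz : N.boundary z = 0) :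
    ∃ ψ : N.Face →₀ ZMod 2,
      ∀ d, z (N.edgeOf d) = ψ (N.leftFace d) + ψ (N.leftFace (N.rev d)) := by
  -- The coefficients are the edge chains modulo boundaries of face chains, and the cocycle sends an
  -- edge to its class. Its primitive factors the quotient map through `boundary`, so cycles have
  -- class zero. This is why `IsAcyclic` allows arbitrary modules.
  obtain ⟨h, hh⟩ := hN ((N.Edge →₀ ZMod 2) ⧸ N.faceBoundaries)
    (fun d => N.faceBoundaries.mkQ (Finsupp.single (N.edgeOf d) 1)) (fun d => by simp)
    (fun d => by
      rw [← map_sum, Submodule.mkQ_apply, Submodule.Quotient.mk_eq_zero]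
      exact sum_facial_mem_faceBoundaries hf d)
  have e : N.faceBoundaries.mkQ = Finsupp.linearCombination (ZMod 2) h ∘ₗ N.boundary := by
    refine Finsupp.lhom_ext' fun e => LinearMap.ext_ring ?_
    obtain ⟨d, rfl⟩ := exists_edgeOf e
    simp only [LinearMap.comp_apply, Finsupp.lsingle_apply]
    rw [boundary_single, map_add, Finsupp.linearCombination_single,
      Finsupp.linearCombination_single, hh, one_smul, one_smul, ← add_assoc,
      ZModModule.add_self, zero_add]
  have : N.faceBoundaries.mkQ z = 0 := by rw [e, LinearMap.comp_apply, hz, map_zero]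
  rw [Submodule.mkQ_apply, Submodule.Quotient.mk_eq_zero] at this
  exact this

/-- The dual map. -/
def dual (N : CombinatorialMap D) : CombinatorialMap D where
  next := N.face
  rev := N.rev
  rev_rev := N.rev_rev
  rev_ne := N.rev_ne

theorem dual_face : N.dual.face = N.rev * N.next * N.rev := by
  ext d
  simp only [dual, face, Equiv.Perm.mul_apply, mul_inv_rev, inv_inv]
  rw [Equiv.Perm.inv_eq_iff_eq, N.rev_rev]

theorem dual_face_pow (m : ℕ) (d : D) :
    (N.dual.face ^ m) d = N.rev ((N.next ^ m) (N.rev d)) := by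
  induction m with
  | zero => simp [N.rev_rev]
  | succ m ih =>
    rw [pow_succ', Equiv.Perm.mul_apply, ih, dual_face, pow_succ']
    simp [N.rev_rev]

theorem isPeriodicPt_dual_face {m : ℕ} {d : D} :
    IsPeriodicPt N.dual.face m d ↔ IsPeriodicPt N.next m (N.rev d) := by
  simp only [IsPeriodicPt, IsFixedPt, Equiv.Perm.iterate_eq_pow, dual_face_pow]
  constructor
  · intro h; rw [← N.rev_rev ((N.next ^ m) (N.rev d)), h]
  · intro h; rw [h, N.rev_rev]

theorem minimalPeriod_dual_face (d : D) :
    minimalPeriod N.dual.face d = minimalPeriod N.next (N.rev d) :=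
  Nat.dvd_antisymm
    (isPeriodicPt_dual_face.mpr (isPeriodicPt_minimalPeriod _ _)).minimalPeriod_dvd
    (isPeriodicPt_dual_face.mp (isPeriodicPt_minimalPeriod _ _)).minimalPeriod_dvd

theorem IsLocallyFinite.dual (hN : N.IsLocallyFinite) : N.dual.IsLocallyFinite where
  next := hN.face
  face d := by
    obtain ⟨n, hn, h⟩ := hN.next (N.rev d)
    exact ⟨n, hn, isPeriodicPt_dual_face.mpr h⟩

/-- A dual cocycle sums to zero around vertices, so it has a primitive `k` on the angles around each
vertex. The sum of `k` over the two angles on one side of an edge is the same for both sides and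
telescopes around faces, so it has a primitive `h` on the vertices. Then `k + h` is constant around
each face and is the required function on dual vertices. -/
theorem IsAcyclic.dual (hN : N.IsAcyclic) (hf : N.IsLocallyFinite) : N.dual.IsAcyclic := by
  intro G _ _ β hrev hface
  have hrev : ∀ d, β (N.rev d) = β d := hrev
  have hsum : ∀ d, ∑ m ∈ range (minimalPeriod N.next d), β ((N.next ^ m) d) = 0 := by
    intro d
    have := hface (N.rev d)
    rw [minimalPeriod_dual_face, N.rev_rev] at this
    simpa only [dual_face_pow, N.rev_rev, hrev] using this
  obtain ⟨k, hk⟩ := exists_primitive_of_orbit_sum_eq_zero hf.next (fun d => β (N.next d))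
    (fun d => by
      have := hsum (N.next d)
      rw [minimalPeriod_apply (hf.next d)] at this
      rw [← this]
      refine sum_congr rfl fun m _ => ?_
      rw [← Equiv.Perm.mul_apply, ← Equiv.Perm.mul_apply, ← pow_succ, ← pow_succ'])
  have hk1 : ∀ d, k (N.rev d) = k (N.face d) + β d := by
    intro d; rw [← next_face, hk, next_face, hrev]
  have hk2 : ∀ d, k (N.face (N.rev d)) = k d + β d := by
    intro d
    have h : N.next (N.face (N.rev d)) = d := by rw [next_face, N.rev_rev]
    have := hk (N.face (N.rev d))
    rw [h] at this
    rw [this, add_assoc, ZModModule.add_self, add_zero]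
  obtain ⟨h, hh⟩ := hN G (fun d => k (N.face d) + k d)
    (fun d => by
      rw [hk1, hk2]
      have := ZModModule.add_self (β d)
      calc k d + β d + (k (N.face d) + β d) = k (N.face d) + k d + (β d + β d) := by abel
        _ = _ := by rw [this, add_zero])
    (fun d => by
      have : ∀ n, ∑ m ∈ range n, (k (N.face ((N.face ^ m) d)) + k ((N.face ^ m) d)) =
          k ((N.face ^ n) d) + k d := by
        intro n
        induction n with
        | zero => simp [ZModModule.add_self]
        | succ n ih =>
          rw [sum_range_succ, ih, pow_succ', Equiv.Perm.mul_apply]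
          have := ZModModule.add_self (k ((N.face ^ n) d))
          calc _ = k (N.face ((N.face ^ n) d)) + k d +
                (k ((N.face ^ n) d) + k ((N.face ^ n) d)) := by abel
            _ = _ := by rw [this, add_zero]
      rw [this, ← Equiv.Perm.iterate_eq_pow, iterate_minimalPeriod, ZModModule.add_self])
  have step : ∀ d, k (N.face d) + h (N.origin (N.face d)) = k d + h (N.origin d) := by
    intro d
    rw [origin_face, hh]
    have := ZModModule.add_self (k (N.face d))
    calc _ = k d + h (N.origin d) + (k (N.face d) + k (N.face d)) := by abel
      _ = _ := by rw [this, add_zero]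
  have hpow : ∀ (n : ℕ) d, k ((N.face ^ n) d) + h (N.origin ((N.face ^ n) d)) =
      k d + h (N.origin d) := by
    intro n d
    induction n with
    | zero => rfl
    | succ n ih => rw [pow_succ', Equiv.Perm.mul_apply, step, ih]
  refine ⟨Quotient.lift (fun d => k d + h (N.origin d)) ?_, fun d => ?_⟩
  · intro a b hab
    obtain ⟨m, -, rfl⟩ := (sameCycle_iff_exists_lt_minimalPeriod (hf.face a)).mp hab
    exact (hpow m a).symm
  · change k (N.rev d) + h (N.target d) = k d + h (N.origin d) + β d
    rw [hh, hk1]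
    have := ZModModule.add_self (k (N.face d))
    calc _ = k d + h (N.origin d) + β d + (k (N.face d) + k (N.face d)) := by abel
      _ = _ := by rw [this, add_zero]

/-- In an acyclic map, a vertex cochain with finitely supported coboundary differs from a finitely
supported one by a locally constant function. -/
theorem IsAcyclic.exists_finsupp_coboundary (hN : N.IsAcyclic) (hf : N.IsLocallyFinite)
    (f : N.Vertex → ZMod 2) (hfin : {d | f (N.origin d) ≠ f (N.target d)}.Finite) :
    ∃ g : N.Vertex →₀ ZMod 2,
      ∀ d, f (N.target d) + g (N.target d) = f (N.origin d) + g (N.origin d) := by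
  classical
  have hwd : ∀ d, f (N.origin (N.edgeOf d).out) + f (N.target (N.edgeOf d).out) =
      f (N.origin d) + f (N.target d) := by
    intro d
    have h : N.edgeOf (N.edgeOf d).out = N.edgeOf d := Quotient.out_eq _
    rcases edgeOf_eq_edgeOf.mp h.symm with h | h
    · rw [h]
    · rw [h, target_rev, add_comm]; rfl
  -- The coboundary of `f`, read as a chain of dual edges, is a cycle because it telescopes around
  -- each face. A finite chain of dual faces that it bounds is the correction `g`.
  let z : N.dual.Edge →₀ ZMod 2 := Finsupp.ofSupportFinite
    (fun e : N.Edge => f (N.origin e.out) + f (N.target e.out)) (by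
      refine (hfin.image N.edgeOf).subset fun e he => ?_
      refine ⟨e.out, fun h => he ?_, Quotient.out_eq _⟩
      simp only [h]
      exact ZModModule.add_self _)
  have hz : ∀ d, z (N.dual.edgeOf d) = f (N.origin d) + f (N.target d) := hwd
  have hb : N.dual.boundary z = 0 := by
    ext φ
    obtain ⟨d, rfl⟩ := exists_origin φ
    rw [boundary_apply (hf.dual.next d), Finsupp.zero_apply]
    simp only [hz]
    rw [sum_orbitFinset d (fun y => f (N.origin y) + f (N.target y))]
    have : ∀ n, ∑ m ∈ range n, (f (N.origin ((N.face ^ m) d)) + f (N.target ((N.face ^ m) d))) =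
        f (N.origin d) + f (N.origin ((N.face ^ n) d)) := by
      intro n
      induction n with
      | zero => simp [ZModModule.add_self]
      | succ n ih =>
        rw [sum_range_succ, ih, pow_succ', Equiv.Perm.mul_apply, origin_face, add_assoc,
          ← add_assoc (f (N.origin ((N.face ^ n) d))), ZModModule.add_self, zero_add]
    refine (this _).trans ?_
    change _ + f (N.origin ((N.face ^ minimalPeriod N.face d) d)) = 0
    rw [← Equiv.Perm.iterate_eq_pow, iterate_minimalPeriod, ZModModule.add_self]
  obtain ⟨ψ, hψ⟩ := (hN.dual hf).exists_faceChain hf.dual.face hb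
  have hlift : ∀ d d', N.next.SameCycle d d' →
      N.dual.leftFace (N.rev d) = N.dual.leftFace (N.rev d') := by
    intro d d' h
    rw [leftFace_eq_leftFace]
    obtain ⟨m, -, rfl⟩ := (sameCycle_iff_exists_lt_minimalPeriod (hf.next d)).mp h
    refine ⟨m, ?_⟩
    rw [zpow_natCast, dual_face_pow, N.rev_rev]
  -- The face permutation of the dual is `next` conjugated by `rev`; hence the `rev` in the
  -- identification of vertices with dual faces.
  let τ : N.Vertex → N.dual.Face := Quotient.lift (fun d => N.dual.leftFace (N.rev d)) hlift
  have hτ : Injective τ := by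
    intro v w
    obtain ⟨d, rfl⟩ := exists_origin v
    obtain ⟨d', rfl⟩ := exists_origin w
    intro h
    have h : N.dual.leftFace (N.rev d) = N.dual.leftFace (N.rev d') := h
    rw [leftFace_eq_leftFace,
      sameCycle_iff_exists_lt_minimalPeriod (hf.dual.face _)] at h
    obtain ⟨m, -, hm⟩ := h
    rw [dual_face_pow, N.rev_rev, EmbeddingLike.apply_eq_iff_eq] at hm
    rw [origin_eq_origin]
    exact ⟨m, by rw [zpow_natCast, hm]⟩
  refine ⟨ψ.comapDomain τ hτ.injOn, fun d => ?_⟩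
  have h := hψ d
  rw [hz] at h
  have h1 : ψ.comapDomain τ hτ.injOn (N.origin d) = ψ (N.dual.leftFace (N.dual.rev d)) := rfl
  have h2 : ψ.comapDomain τ hτ.injOn (N.target d) = ψ (N.dual.leftFace d) := by
    change ψ (N.dual.leftFace (N.rev (N.rev d))) = _
    rw [N.rev_rev]
  rw [h1, h2]
  clear h1 h2
  generalize ψ (N.dual.leftFace (N.dual.rev d)) = a at h ⊢
  generalize ψ (N.dual.leftFace d) = b at h ⊢
  generalize f (N.target d) = x at h ⊢
  generalize f (N.origin d) = y at h ⊢
  clear hfin hwd z hz hb ψ hψ hlift τ hτ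
  revert a b x y
  decide


/-! ### Local finiteness, acyclicity and connectedness of the universal cover -/

variable {D : Type u} {M : CombinatorialMap D} {v₀ : M.Vertex}

theorem universalCover_face_val (p : M.CoverDart v₀) :
    ((M.universalCover v₀).face p).1 = (p.1.1.snoc p.1.2, M.face p.1.2) := rfl

namespace HomotopyClass

/-- The class of the trivial walk. -/
def base (v₀ : M.Vertex) : M.HomotopyClass v₀ := mk ⟨[], v₀, rfl⟩

theorem endpoint_base : (base v₀).endpoint = v₀ := endpoint_mk _ rfl

theorem foldl_snoc_mk (p : M.WalkFrom v₀) (w : List D) {v : M.Vertex}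
    (h : M.IsWalk v₀ (p.1 ++ w) v) : w.foldl snoc (mk p) = mk ⟨p.1 ++ w, v, h⟩ := by
  induction w generalizing p with
  | nil => exact congrArg mk (Subtype.ext (List.append_nil _).symm)
  | cons d w ih =>
    obtain ⟨y, hp, hd, hw⟩ := isWalk_append.mp h
    have e : (mk p).endpoint = M.origin d := (endpoint_mk p hp).trans hd.symm
    rw [List.foldl_cons, snoc_mk p d e, ih _ (by simpa using h)]
    exact congrArg mk (Subtype.ext (by simp))

theorem isWalk_append_of_endpoint (p : M.WalkFrom v₀) {w : List D} {v : M.Vertex}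
    (h : M.IsWalk (mk p).endpoint w v) : M.IsWalk v₀ (p.1 ++ w) v := by
  obtain ⟨y, hy⟩ := p.2
  rw [endpoint_mk p hy] at h
  exact isWalk_append.mpr ⟨y, hy, h⟩

theorem endpoint_foldl_snoc (x : M.HomotopyClass v₀) {w : List D} {v : M.Vertex}
    (h : M.IsWalk x.endpoint w v) : (w.foldl snoc x).endpoint = v := by
  obtain ⟨p, rfl⟩ := x.exists_mk
  rw [foldl_snoc_mk p w (isWalk_append_of_endpoint p h)]
  exact endpoint_mk _ (isWalk_append_of_endpoint p h)

theorem foldl_snoc_facialWalk (x : M.HomotopyClass v₀) (d : D) (h : x.endpoint = M.origin d) :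
    (M.facialWalk d).foldl snoc x = x := by
  obtain ⟨p, rfl⟩ := x.exists_mk
  have hw : M.IsWalk (mk p).endpoint (M.facialWalk d) (M.origin d) := by
    rw [h]; exact isWalk_facialWalk d
  rw [foldl_snoc_mk p _ (isWalk_append_of_endpoint p hw)]
  exact (mk_eq_mk (by simpa using Step.facial (M := M) p.1 [] d)).symm

end HomotopyClass

open HomotopyClass

theorem universalCover_face_pow_val (p : M.CoverDart v₀) (m : ℕ) :
    (((M.universalCover v₀).face ^ m) p).1 =
      (((List.range m).map fun i => (M.face ^ i) p.1.2).foldl snoc p.1.1,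
        (M.face ^ m) p.1.2) := by
  induction m with
  | zero => rfl
  | succ m ih =>
    rw [pow_succ', Equiv.Perm.mul_apply, universalCover_face_val, ih, List.range_succ,
      List.map_append, List.foldl_append, pow_succ', Equiv.Perm.mul_apply]
    rfl

theorem universalCover_next_pow_val (p : M.CoverDart v₀) (m : ℕ) :
    (((M.universalCover v₀).next ^ m) p).1 = (p.1.1, (M.next ^ m) p.1.2) := by
  induction m with
  | zero => rfl
  | succ m ih =>
    rw [pow_succ', Equiv.Perm.mul_apply, pow_succ', Equiv.Perm.mul_apply]
    change (Prod.mk _ _) = _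
    rw [ih]

/-- Facial walks are null-homotopic, so the lift of a face closes up after one turn. -/
theorem isPeriodicPt_universalCover_face (p : M.CoverDart v₀) :
    IsPeriodicPt (M.universalCover v₀).face (minimalPeriod M.face p.1.2) p := by
  rw [IsPeriodicPt, IsFixedPt, Equiv.Perm.iterate_eq_pow]
  refine Subtype.ext ?_
  rw [universalCover_face_pow_val]
  refine Prod.ext (foldl_snoc_facialWalk _ _ p.2) ?_
  change (M.face ^ _) p.1.2 = p.1.2
  rw [← Equiv.Perm.iterate_eq_pow, iterate_minimalPeriod]

theorem minimalPeriod_universalCover_face (p : M.CoverDart v₀) :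
    minimalPeriod (M.universalCover v₀).face p = minimalPeriod M.face p.1.2 := by
  refine Nat.dvd_antisymm (isPeriodicPt_universalCover_face p).minimalPeriod_dvd
    (IsPeriodicPt.minimalPeriod_dvd ?_)
  rw [IsPeriodicPt, IsFixedPt, Equiv.Perm.iterate_eq_pow]
  have h : ((M.universalCover v₀).face ^ minimalPeriod (M.universalCover v₀).face p) p = p := by
    rw [← Equiv.Perm.iterate_eq_pow, iterate_minimalPeriod]
  have := universalCover_face_pow_val p (minimalPeriod (M.universalCover v₀).face p)
  rw [h] at this
  exact (congrArg Prod.snd this).symm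

theorem isLocallyFinite_universalCover [Finite D] : (M.universalCover v₀).IsLocallyFinite where
  next p := by
    obtain ⟨n, hn, h⟩ := M.next.injective.mem_periodicPts p.1.2
    refine ⟨n, hn, ?_⟩
    rw [IsPeriodicPt, IsFixedPt, Equiv.Perm.iterate_eq_pow] at h ⊢
    refine Subtype.ext ?_
    rw [universalCover_next_pow_val, h]
  face p := ⟨_, minimalPeriod_pos_of_mem_periodicPts (M.face.injective.mem_periodicPts _),
    isPeriodicPt_universalCover_face p⟩

section LiftSum

variable {G : Type*} [AddCommGroup G] (β : M.CoverDart v₀ → G)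

open Classical in
/-- The sum of a cochain of the universal cover along a lifted walk. -/
noncomputable def liftSum : M.HomotopyClass v₀ → List D → G
  | _, [] => 0
  -- The default `0` never enters along a walk from the endpoint of `x`, where each dart leaves the
  -- endpoint of the current class.
  | x, d :: w => (if h : x.endpoint = M.origin d then β ⟨(x, d), h⟩ else 0) +
      liftSum (x.snoc d) w

theorem liftSum_append (x : M.HomotopyClass v₀) (u w : List D) :
    liftSum β x (u ++ w) = liftSum β x u + liftSum β (u.foldl snoc x) w := by
  induction u generalizing x with
  | nil => simp [liftSum]
  | cons d u ih => simp [liftSum, ih, add_assoc]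

theorem liftSum_singleton (p : M.CoverDart v₀) : liftSum β p.1.1 [p.1.2] = β p := by
  have := p.2
  simp [liftSum, this]

theorem liftSum_face_range (p : M.CoverDart v₀) (n : ℕ) :
    liftSum β p.1.1 ((List.range n).map fun i => (M.face ^ i) p.1.2) =
      ∑ m ∈ Finset.range n, β (((M.universalCover v₀).face ^ m) p) := by
  induction n with
  | zero => simp [liftSum]
  | succ n ih =>
    rw [List.range_succ, List.map_append, liftSum_append, ih, sum_range_succ,
      ← liftSum_singleton β (((M.universalCover v₀).face ^ n) p), universalCover_face_pow_val]
    rfl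

variable {β}

/-- The inserted spur or facial walk has sum zero and leads back to the same class, so the terms
after it are unchanged. -/
theorem liftSum_eq_of_step
    (hrev : ∀ p, β ((M.universalCover v₀).rev p) + β p = 0)
    (hface : ∀ p, ∑ m ∈ Finset.range (minimalPeriod (M.universalCover v₀).face p),
      β (((M.universalCover v₀).face ^ m) p) = 0)
    {p q : M.WalkFrom v₀} (h : M.Step p.1 q.1) :
    liftSum β (base v₀) p.1 = liftSum β (base v₀) q.1 := by
  obtain ⟨p, hp⟩ := p
  obtain ⟨q, v, hq⟩ := q
  cases h with
  | spur a b d =>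
    obtain ⟨y, ha, hd, -⟩ := isWalk_append.mp hq
    have hy : (a.foldl snoc (base v₀)).endpoint = M.origin d := by
      rw [hd]
      exact endpoint_foldl_snoc _ (by rwa [endpoint_base])
    have e : liftSum β (a.foldl snoc (base v₀)) [d, M.rev d] = 0 := by
      have h1 := liftSum_append β (a.foldl snoc (base v₀)) [d] [M.rev d]
      have h2 := liftSum_singleton β ⟨(_, d), hy⟩
      have h3 := liftSum_singleton β ((M.universalCover v₀).rev ⟨(_, d), hy⟩)
      exact h1.trans ((congrArg₂ (· + ·) h2 h3).trans ((add_comm _ _).trans (hrev _)))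
    change liftSum β _ (a ++ b) = liftSum β _ (a ++ ([d, M.rev d] ++ b))
    simp only [liftSum_append β _ a, liftSum_append β _ [d, M.rev d], e, zero_add]
    simp only [List.foldl_cons, List.foldl_nil]
    rw [snoc_snoc_rev _ _ hy]
  | facial a b d =>
    obtain ⟨y, ha, hw⟩ := isWalk_append.mp hq
    obtain ⟨z, hd, -⟩ := isWalk_append.mp hw
    change liftSum β _ (a ++ b) = liftSum β _ (a ++ (M.facialWalk d ++ b))
    -- `minimalPeriod` is `0` on an infinite orbit; the facial walk is then empty.
    by_cases hnil : M.facialWalk d = []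
    · rw [hnil]; rfl
    have hd' := IsWalk.unique_start hnil hd (isWalk_facialWalk d)
    have hy : (a.foldl snoc (base v₀)).endpoint = M.origin d := by
      rw [← hd']
      exact endpoint_foldl_snoc _ (by rwa [endpoint_base])
    have e : liftSum β (a.foldl snoc (base v₀)) (M.facialWalk d) = 0 := by
      have h1 := hface ⟨(_, d), hy⟩
      rw [minimalPeriod_universalCover_face] at h1
      exact (liftSum_face_range β ⟨(_, d), hy⟩ _).trans h1
    simp only [liftSum_append β _ a, liftSum_append β _ (M.facialWalk d), e, zero_add]
    rw [foldl_snoc_facialWalk _ _ hy]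

end LiftSum

theorem fst_eq_of_sameCycle_universalCover_next {p q : M.CoverDart v₀}
    (h : (M.universalCover v₀).next.SameCycle p q) : p.1.1 = q.1.1 := by
  have h1 : ∀ r : M.CoverDart v₀, ((M.universalCover v₀).next r).1.1 = r.1.1 := fun _ => rfl
  have h2 : ∀ r : M.CoverDart v₀, ((M.universalCover v₀).next⁻¹ r).1.1 = r.1.1 := fun _ => rfl
  obtain ⟨i, rfl⟩ := h
  induction i with
  | zero => rfl
  | succ i ih => rw [add_comm, zpow_add, zpow_one, Equiv.Perm.mul_apply, h1, ← ih]
  | pred i ih => rw [sub_eq_add_neg, add_comm, zpow_add, zpow_neg_one, Equiv.Perm.mul_apply, h2,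
      ← ih]

/-- A primitive is obtained by integration: the sum along a walk from the base point depends only on
its homotopy class, hence only on the vertex of the cover. Symmetric cochains are also
antisymmetric, as the coefficients have characteristic 2. -/
theorem isAcyclic_universalCover : (M.universalCover v₀).IsAcyclic := by
  intro G _ _ β hrev hface
  let H : M.HomotopyClass v₀ → G := Quot.lift
    (fun p : M.WalkFrom v₀ => liftSum β (base v₀) p.1)
    (fun p q h => liftSum_eq_of_step
      (fun p => by rw [hrev]; exact ZModModule.add_self _) hface h)
  have hH : ∀ p : M.CoverDart v₀, H (p.1.1.snoc p.1.2) = H p.1.1 + β p := by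
    rintro ⟨⟨x, d⟩, h⟩
    obtain ⟨p, rfl⟩ := x.exists_mk
    change H ((HomotopyClass.mk p).snoc d) = H (HomotopyClass.mk p) + _
    rw [snoc_mk p d h]
    change liftSum β _ (p.1 ++ [d]) = liftSum β _ p.1 + _
    rw [liftSum_append]
    congr 1
    have e : p.1.foldl snoc (base v₀) = HomotopyClass.mk p := by
      obtain ⟨v, hv⟩ := p.2
      exact foldl_snoc_mk ⟨[], v₀, rfl⟩ p.1 hv
    rw [e]
    exact liftSum_singleton β ⟨(HomotopyClass.mk p, d), h⟩
  exact ⟨Quotient.lift (fun p : M.CoverDart v₀ => H p.1.1)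
    (fun p q h => congrArg H (fst_eq_of_sameCycle_universalCover_next h)), fun p => hH p⟩

theorem origin_universalCover_eq [Finite D] {p q : M.CoverDart v₀} (h : p.1.1 = q.1.1) :
    (M.universalCover v₀).origin p = (M.universalCover v₀).origin q := by
  obtain ⟨⟨x, d⟩, hp⟩ := p
  obtain ⟨⟨y, d'⟩, hq⟩ := q
  obtain rfl : x = y := h
  have h : M.origin d = M.origin d' := hp.symm.trans hq
  obtain ⟨m, -, hm⟩ := (sameCycle_iff_exists_lt_minimalPeriod
    (M.next.injective.mem_periodicPts d)).mp (origin_eq_origin.mp h)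
  rw [origin_eq_origin]
  refine ⟨m, Subtype.ext ?_⟩
  rw [zpow_natCast, universalCover_next_pow_val, hm]

/-- A function on the vertices of the universal cover that is constant along darts is constant. -/
theorem universalCover_eq_of_forall_dart [Finite D] {β : Type*}
    (f : (M.universalCover v₀).Vertex → β)
    (hf : ∀ p, f ((M.universalCover v₀).target p) = f ((M.universalCover v₀).origin p))
    (v w : (M.universalCover v₀).Vertex) : f v = f w := by
  have key : ∀ (l : List D) (y : M.Vertex) (hl : M.IsWalk v₀ l y) (p q : M.CoverDart v₀),
      p.1.1 = base v₀ → q.1.1 = HomotopyClass.mk ⟨l, y, hl⟩ →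
      f ((M.universalCover v₀).origin q) = f ((M.universalCover v₀).origin p) := by
    intro l
    induction l using List.reverseRecOn with
    | nil =>
      intro y hl p q hp hq
      rw [origin_universalCover_eq (hq.trans hp.symm)]
    | append_singleton l d ih =>
      intro y hl p q hp hq
      obtain ⟨x, hx, hd, rfl⟩ := isWalk_append.mp hl
      have hr : (HomotopyClass.mk ⟨l, x, hx⟩ : M.HomotopyClass v₀).endpoint = M.origin d :=
        (endpoint_mk _ hx).trans hd.symm
      refine Eq.trans ?_ ((hf ⟨(_, d), hr⟩).trans (ih x hx p ⟨(_, d), hr⟩ hp rfl))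
      exact congrArg f (origin_universalCover_eq (hq.trans (snoc_mk _ d hr).symm))
  obtain ⟨p, rfl⟩ := exists_origin v
  obtain ⟨q, rfl⟩ := exists_origin w
  obtain ⟨d, hd⟩ := exists_origin v₀
  have hb : (base v₀).endpoint = M.origin d := endpoint_base.trans hd.symm
  obtain ⟨⟨l, y, hl⟩, hp⟩ := p.1.1.exists_mk
  obtain ⟨⟨l', y', hl'⟩, hq⟩ := q.1.1.exists_mk
  rw [key l y hl ⟨(_, d), hb⟩ p rfl hp.symm, key l' y' hl' ⟨(_, d), hb⟩ q rfl hq.symm]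

end CombinatorialMap

/-! ### An Euler characteristic inequality, and winding labels -/

/-- If the kernel of `b` is contained in the range of `a` and `a` is not injective, then the Euler
characteristic of `a`, `b` is positive. -/
theorem finrank_add_one_le_of_ker_le_range {K A B C : Type*} [DivisionRing K]
    [AddCommGroup A] [Module K A] [FiniteDimensional K A]
    [AddCommGroup B] [Module K B] [FiniteDimensional K B]
    [AddCommGroup C] [Module K C] [FiniteDimensional K C]
    (a : A →ₗ[K] B) (b : B →ₗ[K] C) (hab : LinearMap.ker b ≤ LinearMap.range a)
    {x : A} (hx : x ≠ 0) (hax : a x = 0) :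
    Module.finrank K B + 1 ≤ Module.finrank K A + Module.finrank K C := by
  have h1 := a.finrank_range_add_finrank_ker
  have h2 := b.finrank_range_add_finrank_ker
  have h3 := Submodule.finrank_mono hab
  have h4 := (LinearMap.range b).finrank_le
  have h5 : 0 < Module.finrank K (LinearMap.ker a) := by
    have : Nontrivial (LinearMap.ker a) :=
      ⟨⟨x, hax⟩, 0, fun h => hx (congrArg Subtype.val h)⟩
    exact Module.finrank_pos
  omega

/-- Labels that increase by `0` or `1` along `π` and are constant on no orbit. -/
structure IsWinding {α : Type*} (π : Equiv.Perm α) (ℓ : α → ZMod 3) : Prop where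
  step : ∀ x, ℓ (π x) = ℓ x ∨ ℓ (π x) = ℓ x + 1
  jump : ∀ x, ∃ y, π.SameCycle x y ∧ ℓ (π y) ≠ ℓ y

namespace IsWinding

variable {α : Type*} {π : Equiv.Perm α} {ℓ : α → ZMod 3}

/-- Without a later change out of `c + 1` the label would stay there forever, and could not return
to `c` at `x`. -/
theorem exists_jump_of_jump (h : IsWinding π ℓ) {x : α} (hx : x ∈ periodicPts π) {c : ZMod 3}
    (h1 : ℓ x = c) (h2 : ℓ (π x) = c + 1) :
    ∃ y, π.SameCycle x y ∧ ℓ y = c + 1 ∧ ℓ (π y) = c + 1 + 1 := by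
  by_contra! hne
  have key : ∀ n : ℕ, ℓ ((π ^ (n + 1)) x) = c + 1 := by
    intro n
    induction n with
    | zero => simpa using h2
    | succ n ih =>
      rw [pow_succ', Equiv.Perm.mul_apply]
      rcases h.step ((π ^ (n + 1)) x) with h3 | h3
      · rw [h3, ih]
      · rw [ih] at h3
        exact absurd h3 (hne _ ⟨(n + 1 : ℕ), by rw [zpow_natCast]⟩ ih)
  obtain ⟨n, hn, hp⟩ := hx
  obtain ⟨n, rfl⟩ := Nat.exists_eq_succ_of_ne_zero hn.ne'
  have := key n
  rw [IsPeriodicPt, IsFixedPt, Equiv.Perm.iterate_eq_pow] at hp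
  rw [hp, h1] at this
  simp at this

theorem exists_jump (h : IsWinding π ℓ) (hπ : ∀ x, x ∈ periodicPts π) (x : α) (c : ZMod 3) :
    ∃ y, π.SameCycle x y ∧ ℓ y = c ∧ ℓ (π y) = c + 1 := by
  obtain ⟨y₀, hy₀, hj⟩ := h.jump x
  have h0 : ℓ (π y₀) = ℓ y₀ + 1 := (h.step y₀).resolve_left hj
  obtain ⟨y₁, hy₁, h1, h1'⟩ := h.exists_jump_of_jump (hπ y₀) rfl h0
  obtain ⟨y₂, hy₂, h2, h2'⟩ := h.exists_jump_of_jump (hπ y₁) h1 h1'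
  have : c = ℓ y₀ ∨ c = ℓ y₀ + 1 ∨ c = ℓ y₀ + 1 + 1 := by
    generalize ℓ y₀ = a
    revert a c; decide
  rcases this with rfl | rfl | rfl
  · exact ⟨y₀, hy₀, rfl, h0⟩
  · exact ⟨y₁, hy₀.trans hy₁, h1, h1'⟩
  · exact ⟨y₂, (hy₀.trans hy₁).trans hy₂, h2, h2'⟩

theorem three_le_card (h : IsWinding π ℓ) (hπ : ∀ x, x ∈ periodicPts π) (x : α) (s : Finset α)
    (hs : ∀ y, π.SameCycle x y → ℓ (π y) ≠ ℓ y → y ∈ s) : 3 ≤ s.card := by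
  choose y hy h1 h2 using h.exists_jump hπ x
  have hinj : Injective y := fun c c' hc => by rw [← h1 c, hc, h1]
  have : (univ : Finset (ZMod 3)).card ≤ s.card :=
    card_le_card_of_injOn y (fun c _ => hs _ (hy c) (by rw [h1, h2]; simp)) hinj.injOn
  simpa using this

end IsWinding

/-! ### Discrete Gauss-Bonnet for bounded regions -/

namespace CombinatorialMap

variable {D : Type u} {N : CombinatorialMap D}

theorem leftFace_rev_next (d : D) : N.leftFace (N.rev (N.next d)) = N.leftFace d := by
  conv_rhs => rw [← face_rev_next d, leftFace_face]

theorem leftFace_next_eq {ψ : N.Face → ZMod 2} {d : D}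
    (h : ψ (N.leftFace (N.next d)) = ψ (N.leftFace (N.rev (N.next d)))) :
    ψ (N.leftFace (N.next d)) = ψ (N.leftFace d) := by
  rw [h, leftFace_rev_next]

theorem sum_boundary (z : N.Edge →₀ ZMod 2) :
    Finsupp.linearCombination (ZMod 2) (fun _ => (1 : ZMod 2)) (N.boundary z) = 0 := by
  have : Finsupp.linearCombination (ZMod 2) (fun _ => (1 : ZMod 2)) ∘ₗ N.boundary = 0 := by
    refine Finsupp.lhom_ext' fun e => LinearMap.ext_ring ?_
    obtain ⟨d, rfl⟩ := exists_edgeOf e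
    simp only [LinearMap.comp_apply, Finsupp.lsingle_apply]
    rw [boundary_single, map_add, Finsupp.linearCombination_single,
      Finsupp.linearCombination_single]
    exact ZModModule.add_self _
  exact LinearMap.congr_fun this z

/-- The edge set `C` spans a connected graph on the vertex set `VC`. -/
structure IsConnectedOn (N : CombinatorialMap D) (C : Set N.Edge) (VC : Set N.Vertex) : Prop where
  origin_mem : ∀ d, N.edgeOf d ∈ C → N.origin d ∈ VC
  exists_path : ∃ r, ∀ w ∈ VC, ∃ c : N.Edge →₀ ZMod 2, (∀ e, c e ≠ 0 → e ∈ C) ∧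
    N.boundary c = Finsupp.single w 1 + Finsupp.single r 1

/-- Join every vertex of the support of `y` to the root by a chain in `C`. The root then receives
the total sum of `y`, which is zero. -/
theorem IsConnectedOn.exists_boundary_eq {C : Set N.Edge} {VC : Set N.Vertex}
    (hC : N.IsConnectedOn C VC) (y : N.Vertex →₀ ZMod 2) (hy : ∀ v, y v ≠ 0 → v ∈ VC)
    (h0 : Finsupp.linearCombination (ZMod 2) (fun _ => (1 : ZMod 2)) y = 0) :
    ∃ c : N.Edge →₀ ZMod 2, (∀ e, c e ≠ 0 → e ∈ C) ∧ N.boundary c = y := by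
  classical
  obtain ⟨r, hr⟩ := hC.exists_path
  have : ∀ w, ∃ c : N.Edge →₀ ZMod 2, w ∈ VC → (∀ e, c e ≠ 0 → e ∈ C) ∧
      N.boundary c = Finsupp.single w 1 + Finsupp.single r 1 := fun w => by
    by_cases hw : w ∈ VC
    · obtain ⟨c, hc⟩ := hr w hw; exact ⟨c, fun _ => hc⟩
    · exact ⟨0, fun h => absurd h hw⟩
  choose c hc using this
  refine ⟨∑ w ∈ y.support, y w • c w, fun e he => ?_, ?_⟩
  · rw [Finsupp.finsetSum_apply] at he
    obtain ⟨w, hw, hwe⟩ := exists_ne_zero_of_sum_ne_zero he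
    refine (hc w (hy w (Finsupp.mem_support_iff.mp hw))).1 e fun h => hwe ?_
    rw [Finsupp.smul_apply, h, smul_zero]
  · rw [map_sum]
    have : ∀ w ∈ y.support, N.boundary (y w • c w) =
        Finsupp.single w (y w) + Finsupp.single r (y w) := fun w hw => by
      rw [map_smul, (hc w (hy w (Finsupp.mem_support_iff.mp hw))).2]
      simp
    rw [sum_congr rfl this, sum_add_distrib, ← Finsupp.single_finsetSum]
    rw [Finsupp.linearCombination_apply, Finsupp.sum] at h0
    simp only [smul_eq_mul, mul_one] at h0
    rw [h0, Finsupp.single_zero, add_zero]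
    exact Finsupp.sum_single y

/-- The Euler characteristic of an open region whose frontier is connected is positive. -/
theorem IsAcyclic.card_edges_lt (hN : N.IsAcyclic) (hf : N.IsLocallyFinite)
    {C : Set N.Edge} {VC : Set N.Vertex} (hC : N.IsConnectedOn C VC)
    (ψ : N.Face →₀ ZMod 2) (hψ : ψ ≠ 0)
    (hψC : ∀ d, N.edgeOf d ∉ C → ψ (N.leftFace d) = ψ (N.leftFace (N.rev d)))
    (Es : Finset N.Edge) (Vs : Finset N.Vertex)
    (hE : ∀ d, N.edgeOf d ∈ Es ↔ N.edgeOf d ∉ C ∧ ψ (N.leftFace d) ≠ 0)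
    (hV : ∀ d, N.edgeOf d ∈ Es → N.origin d ∉ VC → N.origin d ∈ Vs) :
    Es.card + 1 ≤ ψ.support.card + Vs.card := by
  classical
  let K := ZMod 2
  let a₀ : (N.Face → K) →ₗ[K] (Es → K) :=
    { toFun := fun φ e => φ (N.leftFace e.1.out) + φ (N.leftFace (N.rev e.1.out))
      map_add' := fun φ χ => by ext e; simp only [Pi.add_apply]; ring
      map_smul' := fun c φ => by ext e; simp [mul_add] }
  have ha₀ : ∀ φ d (h : N.edgeOf d ∈ Es), a₀ φ ⟨N.edgeOf d, h⟩ =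
      φ (N.leftFace d) + φ (N.leftFace (N.rev d)) := by
    intro φ d h
    have h1 : N.edgeOf (N.edgeOf d).out = N.edgeOf d := Quotient.out_eq _
    change φ (N.leftFace (N.edgeOf d).out) + φ (N.leftFace (N.rev (N.edgeOf d).out)) = _
    rcases edgeOf_eq_edgeOf.mp h1.symm with h | h
    · rw [h]
    · rw [h, N.rev_rev, add_comm]
  -- `a` is the coboundary from faces of the region to edges inside it, and `b` is the boundary of
  -- such edges, recorded at `Vs` only.
  let a : (ψ.support → K) →ₗ[K] (Es → K) :=
    a₀ ∘ₗ Function.ExtendByZero.linearMap K (Subtype.val : ψ.support → N.Face)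
  have hext : ∀ (φ : N.Face → K) (f : N.Face), ψ f ≠ 0 →
      Function.ExtendByZero.linearMap K (Subtype.val : ψ.support → N.Face) (fun g => φ g) f =
        φ f := fun φ f hf =>
    Subtype.val_injective.extend_apply (fun g : ψ.support => φ g) 0
      ⟨f, Finsupp.mem_support_iff.mpr hf⟩
  have ha : ∀ (φ : N.Face → K) d (h : N.edgeOf d ∈ Es), a (fun g => φ g) ⟨N.edgeOf d, h⟩ =
      φ (N.leftFace d) + φ (N.leftFace (N.rev d)) := by
    intro φ d h
    have h1 := ((hE d).mp h).2
    have h2 := ((hE (N.rev d)).mp (by rwa [edgeOf_rev])).2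
    exact (ha₀ _ d h).trans (congrArg₂ (· + ·) (hext φ _ h1) (hext φ _ h2))
  let ex : (Es → K) →ₗ[K] (N.Edge →₀ K) := Finsupp.lmapDomain K K Subtype.val ∘ₗ
    (Finsupp.linearEquivFunOnFinite K K Es).symm.toLinearMap
  have hex : ∀ z (e : Es), ex z e = z e := fun z e => Finsupp.mapDomain_apply
    Subtype.val_injective ((Finsupp.linearEquivFunOnFinite K K Es).symm z) e
  have hex0 : ∀ z e, e ∉ Es → ex z e = 0 := fun z e he =>
    Finsupp.mapDomain_of_notMem_range _ _ (by simpa using he)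
  let b : (Es → K) →ₗ[K] (Vs → K) :=
    LinearMap.funLeft K K (Subtype.val : Vs → N.Vertex) ∘ₗ Finsupp.lcoeFun ∘ₗ N.boundary ∘ₗ ex
  have hb : ∀ z (v : Vs), b z v = N.boundary (ex z) v := fun _ _ => rfl
  -- For `z` in the kernel of `b`, the boundary of `z` lives on `VC`, so a chain `c` in `C`
  -- completes `z` to a cycle. A face chain bounded by that cycle, restricted to the region, is a
  -- preimage of `z`, since edges in `Es` have the region on both sides.
  have hab : LinearMap.ker b ≤ LinearMap.range a := by
    intro z hz
    obtain ⟨c, hcC, hc⟩ := hC.exists_boundary_eq (N.boundary (ex z)) (fun v hv => by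
      by_contra hvC
      obtain ⟨d, rfl⟩ := exists_origin v
      have hv' := hv
      rw [boundary_apply (hf.next d)] at hv'
      obtain ⟨y, hy, hye⟩ := exists_ne_zero_of_sum_ne_zero hv'
      rw [mem_orbitFinset (hf.next d), ← origin_eq_origin] at hy
      have hyE : N.edgeOf y ∈ Es := by
        by_contra h; exact hye (hex0 z _ h)
      rw [hy] at hv hvC
      exact hv ((hb z ⟨_, hV y hyE hvC⟩).symm.trans (congrFun hz _))) (sum_boundary _)
    obtain ⟨χ, hχ⟩ := hN.exists_faceChain hf.face (z := ex z + c)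
      (by rw [map_add, hc]; exact ZModModule.add_self _)
    refine ⟨fun f => χ f, ?_⟩
    ext ⟨e, he⟩
    obtain ⟨d, rfl⟩ := exists_edgeOf e
    have hcd : c (N.edgeOf d) = 0 := by
      by_contra h; exact ((hE d).mp he).1 (hcC _ h)
    rw [ha χ d he, ← hχ, Finsupp.add_apply, hcd, add_zero, hex z ⟨_, he⟩]
  -- The region itself is a nonzero element of the kernel of `a`; it accounts for the `+ 1`.
  have hx : (fun f : ψ.support => ψ f) ≠ 0 := by
    obtain ⟨f, hf⟩ := Finsupp.ne_iff.mp hψ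
    exact fun h => hf (congrFun h ⟨f, Finsupp.mem_support_iff.mpr hf⟩)
  have hax : a (fun f => ψ f) = 0 := by
    ext ⟨e, he⟩
    obtain ⟨d, rfl⟩ := exists_edgeOf e
    rw [ha ψ d he, hψC d ((hE d).mp he).1]
    exact ZModModule.add_self _
  have := finrank_add_one_le_of_ker_le_range a b hab hx hax
  simpa [K] using this

theorem next_symm_rev (d : D) : N.next.symm (N.rev d) = N.face d := rfl

theorem face_rev (d : D) : N.face (N.rev d) = N.next.symm d := by
  rw [← next_symm_rev, N.rev_rev]

/-- The label does not change at all four sides of the quadrangle formed by the angles of an edge.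
So a labeling that winds around all vertices and faces satisfies the EDGE condition. -/
theorem not_four_jumps {ℓ : D → ZMod 3} (hv : IsWinding N.next ℓ) (hfc : IsWinding N.face ℓ)
    (d : D) (h1 : ℓ (N.face d) ≠ ℓ d) (h2 : ℓ (N.next.symm (N.rev d)) ≠ ℓ (N.rev d))
    (h3 : ℓ (N.face (N.rev d)) ≠ ℓ (N.rev d)) (h4 : ℓ (N.next.symm d) ≠ ℓ d) : False := by
  have e1 := (hfc.step d).resolve_left h1
  have e2 := (hv.step (N.face d)).resolve_left (by rw [next_face]; exact h2.symm)
  have e3 := (hfc.step (N.rev d)).resolve_left h3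
  have e4 := (hv.step (N.next.symm d)).resolve_left
    (by rw [Equiv.apply_symm_apply]; exact h4.symm)
  rw [next_face] at e2
  rw [Equiv.apply_symm_apply, ← face_rev] at e4
  -- Four increments around a closed quadrangle would give `4 = 0` in `ZMod 3`.
  rw [e3, e2, e1] at e4
  generalize ℓ d = x at e4
  revert x; decide

/-- No edge of `C` ends at a vertex off `VC`, so turning around that vertex never crosses the
frontier. -/
theorem leftFace_eq_of_sameCycle (hf : N.IsLocallyFinite) {C : Set N.Edge}
    {VC : Set N.Vertex} (hC : N.IsConnectedOn C VC) {ψ : N.Face → ZMod 2}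
    (hψC : ∀ d, N.edgeOf d ∉ C → ψ (N.leftFace d) = ψ (N.leftFace (N.rev d))) {d d' : D}
    (hd : N.origin d ∉ VC) (h : N.origin d = N.origin d') :
    ψ (N.leftFace d') = ψ (N.leftFace d) := by
  rw [origin_eq_origin, sameCycle_iff_exists_lt_minimalPeriod (hf.next d)] at h
  obtain ⟨m, -, rfl⟩ := h
  induction m with
  | zero => rfl
  | succ m ih =>
    rw [← ih, pow_succ', Equiv.Perm.mul_apply]
    refine leftFace_next_eq (hψC _ fun hm => hd ?_)
    have := hC.origin_mem _ hm
    rw [origin_next] at this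
    rwa [origin_eq_origin.mpr (⟨m, by rw [zpow_natCast]⟩ :
      N.next.SameCycle d ((N.next ^ m) d))]

/-- A discrete Gauss-Bonnet inequality: a bounded region with connected frontier sees at least
three more label changes along the edges of its frontier than at the vertices of its frontier. -/
theorem IsAcyclic.card_vertexJumps_add_three_le (hN : N.IsAcyclic) (hf : N.IsLocallyFinite)
    {ℓ : D → ZMod 3} (hv : IsWinding N.next ℓ) (hfc : IsWinding N.face ℓ)
    {C : Set N.Edge} {VC : Set N.Vertex} (hC : N.IsConnectedOn C VC)
    (ψ : N.Face →₀ ZMod 2) (hψ : ψ ≠ 0)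
    (hψC : ∀ d, N.edgeOf d ∉ C → ψ (N.leftFace d) = ψ (N.leftFace (N.rev d)))
    (X Y : Finset D)
    (hX : ∀ d, N.edgeOf d ∈ C → ψ (N.leftFace d) ≠ 0 → ℓ (N.face d) ≠ ℓ d → d ∈ X)
    (hY : ∀ d ∈ Y, N.edgeOf d ∉ C ∧ ψ (N.leftFace d) ≠ 0 ∧ N.origin d ∈ VC ∧
      ℓ (N.next.symm d) ≠ ℓ d) :
    Y.card + 3 ≤ X.card := by
  classical
  -- `W` is the set of angles of the region. A change along a face is recorded at the angle before
  -- it, a change around a vertex at the dart that is crossed.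
  let W : Finset D := ψ.support.biUnion fun f => orbitFinset N.face f.out
  have hW : ∀ d, d ∈ W ↔ ψ (N.leftFace d) ≠ 0 := by
    intro d
    have h : ∀ f : N.Face, d ∈ orbitFinset N.face f.out ↔ f = N.leftFace d := fun f => by
      rw [mem_orbitFinset (hf.face _), ← leftFace_eq_leftFace]
      have : N.leftFace f.out = f := Quotient.out_eq _
      rw [this]
    simp [W, h]
  have hWrev : ∀ d, N.edgeOf d ∉ C → d ∈ W → N.rev d ∈ W := fun d hd h => by
    rw [hW] at h ⊢; rwa [← hψC d hd]
  have hCV : ∀ d, N.origin d ∉ VC → N.edgeOf d ∉ C := fun d h h' => h (hC.origin_mem d h')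
  let W0 := W.filter fun d => N.edgeOf d ∉ C
  let Jf : D → Prop := fun d => ℓ (N.face d) ≠ ℓ d
  let Jv : D → Prop := fun d => ℓ (N.next.symm d) ≠ ℓ d
  let Wv := W.filter fun d => N.origin d ∉ VC
  let Es := W0.image N.edgeOf
  let Vs := Wv.image N.origin
  have hE : ∀ d, N.edgeOf d ∈ Es ↔ N.edgeOf d ∉ C ∧ ψ (N.leftFace d) ≠ 0 := by
    intro d
    simp only [Es, W0, mem_image, mem_filter]
    constructor
    · rintro ⟨d', ⟨h1, h2⟩, h3⟩
      refine ⟨h3 ▸ h2, ?_⟩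
      rcases edgeOf_eq_edgeOf.mp h3 with rfl | rfl
      · exact (hW _).mp h1
      · exact (hW _).mp (hWrev _ h2 h1)
    · rintro ⟨h1, h2⟩
      exact ⟨d, ⟨(hW d).mpr h2, h1⟩, rfl⟩
  have hχ := hN.card_edges_lt hf hC ψ hψ hψC Es Vs hE (fun d hd hdV =>
    mem_image_of_mem _ (mem_filter.mpr ⟨(hW d).mpr ((hE d).mp hd).2, hdV⟩))
  have hF : ψ.support.card * 3 ≤ (W.filter Jf).card := by
    rw [card_eq_sum_card_fiberwise (f := N.leftFace) (t := ψ.support) (fun d hd =>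
      Finsupp.mem_support_iff.mpr ((hW d).mp (mem_filter.mp hd).1)), ← smul_eq_mul]
    refine card_nsmul_le_sum _ _ _ fun f hfs => ?_
    obtain ⟨d, rfl⟩ := exists_leftFace f
    refine hfc.three_le_card hf.face d _ fun y hy hj => ?_
    rw [← leftFace_eq_leftFace] at hy
    rw [mem_filter, mem_filter, hW, ← hy]
    exact ⟨⟨Finsupp.mem_support_iff.mp hfs, hj⟩, rfl⟩
  have hVt : Vs.card * 3 ≤ (Wv.filter Jv).card := by
    rw [card_eq_sum_card_fiberwise (f := N.origin) (t := Vs) (fun d hd =>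
      mem_image_of_mem _ (mem_filter.mp hd).1), ← smul_eq_mul]
    refine card_nsmul_le_sum _ _ _ fun v hvs => ?_
    obtain ⟨d, hd, rfl⟩ := mem_image.mp hvs
    obtain ⟨hdW, hdV⟩ := mem_filter.mp hd
    -- `three_le_card` indexes a change by the angle before it, `Jv` by the one after it.
    rw [← card_map N.next.symm.toEmbedding]
    refine hv.three_le_card hf.next d _ fun y hy hj => ?_
    rw [← origin_eq_origin] at hy
    rw [mem_map]
    refine ⟨N.next y, ?_, N.next.symm_apply_apply y⟩
    have h1 : N.origin d = N.origin (N.next y) := by rw [origin_next, hy]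
    rw [mem_filter, mem_filter, mem_filter, hW, ← h1]
    refine ⟨⟨⟨?_, hdV⟩, ?_⟩, rfl⟩
    · rw [leftFace_eq_of_sameCycle hf hC (ψ := ψ) hψC hdV h1]
      exact (hW d).mp hdW
    · change ℓ (N.next.symm (N.next y)) ≠ _
      rw [N.next.symm_apply_apply]; exact hj.symm
  have hEt : (W0.filter Jf).card + (W0.filter Jv).card ≤ Es.card * 3 := by
    rw [card_eq_sum_card_fiberwise (f := N.edgeOf) (t := Es) (s := W0.filter Jf) (fun d hd =>
      mem_image_of_mem _ (mem_filter.mp hd).1),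
      card_eq_sum_card_fiberwise (f := N.edgeOf) (t := Es) (s := W0.filter Jv) (fun d hd =>
      mem_image_of_mem _ (mem_filter.mp hd).1), ← sum_add_distrib, ← smul_eq_mul]
    refine sum_le_card_nsmul _ _ _ fun e _ => ?_
    obtain ⟨d, rfl⟩ := exists_edgeOf e
    have hsub : ∀ (J : D → Prop) [DecidablePred J], ((W0.filter J).filter fun y => N.edgeOf y = N.edgeOf d).card ≤
        (if J d then 1 else 0) + (if J (N.rev d) then 1 else 0) := by
      intro J _
      have h1 : ((W0.filter J).filter fun y => N.edgeOf y = N.edgeOf d) ⊆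
          ({d, N.rev d} : Finset D).filter J := by
        intro y hy
        simp only [mem_filter, mem_insert, mem_singleton] at hy ⊢
        exact ⟨edgeOf_eq_edgeOf.mp hy.2.symm, hy.1.2⟩
      refine (card_le_card h1).trans ?_
      rw [card_filter, sum_pair (N.rev_ne d).symm]
    refine (Nat.add_le_add (hsub Jf) (hsub Jv)).trans ?_
    have h3 : ¬ (Jf d ∧ Jf (N.rev d) ∧ Jv d ∧ Jv (N.rev d)) := fun ⟨h1, h2, h3, h4⟩ =>
      not_four_jumps hv hfc d h1 h4 h2 h3
    split_ifs <;> first | omega | exact absurd ⟨‹_›, ‹_›, ‹_›, ‹_›⟩ h3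
  have hWf : (W.filter Jf).card ≤ (W0.filter Jf).card + X.card := by
    refine (card_le_card fun d hd => ?_).trans (card_union_le _ _)
    obtain ⟨h1, h2⟩ := mem_filter.mp hd
    rw [mem_union]
    by_cases hdC : N.edgeOf d ∈ C
    · exact Or.inr (hX d hdC ((hW d).mp h1) h2)
    · exact Or.inl (mem_filter.mpr ⟨mem_filter.mpr ⟨h1, hdC⟩, h2⟩)
  have hWv : (Wv.filter Jv).card + Y.card ≤ (W0.filter Jv).card := by
    rw [← card_union_of_disjoint]
    · refine card_le_card fun d hd => ?_
      rcases mem_union.mp hd with h | h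
      · obtain ⟨h1, h2⟩ := mem_filter.mp h
        obtain ⟨h1, h3⟩ := mem_filter.mp h1
        exact mem_filter.mpr ⟨mem_filter.mpr ⟨h1, hCV d h3⟩, h2⟩
      · obtain ⟨h1, h2, -, h3⟩ := hY d h
        exact mem_filter.mpr ⟨mem_filter.mpr ⟨(hW d).mpr h2, h1⟩, h3⟩
    · rw [disjoint_left]
      intro d h h'
      exact (mem_filter.mp (mem_filter.mp h).1).2 (hY d h').2.2.1
  -- With `F` faces, `V` vertices and `E` edges, the counts give `3F + 3V + |Y| ≤ 3E + |X|`, while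
  -- `3E + 3 ≤ 3F + 3V`.
  omega


/-! ### Regions bounded by straight walks -/

variable {D : Type u} {N : CombinatorialMap D} {ℓ : D → ZMod 3}

/-- If the labels at the two ends of a sector of a vertex differ, then they change at a dart that
lies strictly inside the sector. -/
theorem exists_jump_between (hf : N.IsLocallyFinite) {C : Set N.Edge} {ψ : N.Face → ZMod 2}
    (hψC : ∀ d, N.edgeOf d ∉ C → ψ (N.leftFace d) = ψ (N.leftFace (N.rev d))) {p q : D}
    (hpq : N.origin p = N.origin q)
    (hC : ∀ d, N.origin d = N.origin p → N.edgeOf d ∈ C → d = p ∨ d = q)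
    (hℓ : ℓ p ≠ ℓ (N.next.symm q)) :
    (∃ y, N.origin y = N.origin p ∧ N.edgeOf y ∉ C ∧ ℓ (N.next.symm y) ≠ ℓ y ∧
      ψ (N.leftFace y) = ψ (N.leftFace p)) ∧
    ψ (N.leftFace (N.next.symm q)) = ψ (N.leftFace p) := by
  classical
  -- The exponent `n + 1` forces at least one step: for `p = q` the sector is a full turn.
  have hex : ∃ n, (N.next ^ (n + 1)) p = q := by
    have h' : N.origin p = N.origin (N.next.symm q) := by
      rw [← origin_next (N.next.symm q), Equiv.apply_symm_apply, hpq]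
    rw [origin_eq_origin, sameCycle_iff_exists_lt_minimalPeriod (hf.next p)] at h'
    obtain ⟨n, -, hn⟩ := h'
    exact ⟨n, by rw [pow_succ', Equiv.Perm.mul_apply, hn, Equiv.apply_symm_apply]⟩
  obtain ⟨n, hn, hmin⟩ : ∃ n, (N.next ^ (n + 1)) p = q ∧ ∀ j < n, (N.next ^ (j + 1)) p ≠ q :=
    ⟨Nat.find hex, Nat.find_spec hex, fun j hj => Nat.find_min hex hj⟩
  have horig : ∀ j, N.origin ((N.next ^ j) p) = N.origin p := fun j =>
    origin_eq_origin.mpr (Equiv.Perm.SameCycle.symm ⟨j, by rw [zpow_natCast]⟩)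
  have hint : ∀ j < n, N.edgeOf ((N.next ^ (j + 1)) p) ∉ C := by
    intro j hj h
    rcases hC _ (horig _) h with h | h
    · obtain ⟨c, rfl⟩ := Nat.exists_eq_add_of_lt hj
      refine hmin c (by omega) ?_
      rw [← hn, show j + c + 1 + 1 = (c + 1) + (j + 1) by ring, pow_add _ (c + 1),
        Equiv.Perm.mul_apply, h]
    · exact hmin j hj h
  have hψ : ∀ j ≤ n, ψ (N.leftFace ((N.next ^ j) p)) = ψ (N.leftFace p) := by
    intro j
    induction j with
    | zero => intro _; rfl
    | succ j ih =>
      intro hj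
      rw [← ih (by omega)]
      have := hψC _ (hint j (by omega))
      rw [pow_succ', Equiv.Perm.mul_apply] at this ⊢
      exact leftFace_next_eq this
  have hq : N.next.symm q = (N.next ^ n) p := by
    rw [← hn, pow_succ', Equiv.Perm.mul_apply, Equiv.symm_apply_apply]
  refine ⟨?_, by rw [hq, hψ n le_rfl]⟩
  by_contra! hno
  refine hℓ ?_
  rw [hq]
  have : ∀ j ≤ n, ℓ ((N.next ^ j) p) = ℓ p := by
    intro j
    induction j with
    | zero => intro _; rfl
    | succ j ih =>
      intro hj
      rw [← ih (by omega)]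
      by_contra hne
      refine hno _ (horig (j + 1)) (hint j (by omega)) ?_ (hψ _ hj)
      rw [pow_succ', Equiv.Perm.mul_apply, Equiv.symm_apply_apply]
      rw [pow_succ', Equiv.Perm.mul_apply] at hne
      exact Ne.symm hne
  exact (this n le_rfl).symm

/-- The cycle `T` bounds a finite region, which lies on exactly one side of each edge of `T`. A
label change on that side of `b` forces one in the sector up to the successor `b'`, because `b` and
`b'` carry the same labels on both sides. The resulting vertex changes are distinct, as targets are.
Only the at most two darts of `T₀` are unmatched, against the excess of three. -/
theorem IsAcyclic.false_of_straight_frontier (hN : N.IsAcyclic) (hf : N.IsLocallyFinite)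
    (hv : IsWinding N.next ℓ) (hfc : IsWinding N.face ℓ) (T T₀ : Finset D) (hT₀ : T₀.card ≤ 2)
    (hne : T.Nonempty) (hrev : ∀ b ∈ T, N.rev b ∉ T)
    (hcycle : ∑ b ∈ T, N.boundary (Finsupp.single (N.edgeOf b) 1) = 0)
    {VC : Set N.Vertex} (hC : N.IsConnectedOn (N.edgeOf '' T) VC)
    (hsucc : ∀ b ∈ T, b ∉ T₀ → ∃ b' ∈ T, N.origin b' = N.target b ∧ ℓ b' = ℓ b ∧
      ℓ (N.next.symm b') = ℓ (N.next.symm b) ∧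
      ∀ d, N.origin d = N.target b → N.edgeOf d ∈ N.edgeOf '' T → d = b' ∨ d = N.rev b)
    (hinj : ∀ b ∈ T, b ∉ T₀ → ∀ b' ∈ T, b' ∉ T₀ → N.target b = N.target b' → b = b') :
    False := by
  classical
  obtain ⟨ψ, hψ⟩ := hN.exists_faceChain hf.face
    (z := ∑ b ∈ T, Finsupp.single (N.edgeOf b) 1) (by rw [map_sum, hcycle])
  simp only [Finsupp.finsetSum_apply] at hψ
  have h1 : ∀ b ∈ T, ψ (N.leftFace b) + ψ (N.leftFace (N.rev b)) = 1 := by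
    intro b hb
    rw [← hψ, sum_eq_single b, Finsupp.single_eq_same]
    · intro b' hb' hne
      rw [Finsupp.single_apply, if_neg]
      intro h
      rcases edgeOf_eq_edgeOf.mp h with h | h
      · exact hne h.symm
      · exact hrev b' hb' (h ▸ hb)
    · exact fun h => absurd hb h
  have h2 : ∀ d, N.edgeOf d ∉ N.edgeOf '' T →
      ψ (N.leftFace d) = ψ (N.leftFace (N.rev d)) := by
    intro d hd
    have : ψ (N.leftFace d) + ψ (N.leftFace (N.rev d)) = 0 := by
      rw [← hψ]
      refine sum_eq_zero fun b hb => ?_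
      rw [Finsupp.single_apply, if_neg]
      exact fun h => hd ⟨b, hb, h⟩
    rwa [← sub_eq_zero, ZModModule.sub_eq_add]
  have hψ0 : ψ ≠ 0 := by
    rintro rfl
    obtain ⟨b, hb⟩ := hne
    have := h1 b hb
    simp at this
  -- `base d` is the dart of `T` on the edge of `d`; `X` contains at most one dart per edge because
  -- the region lies on one side only.
  let base : D → D := fun d => if d ∈ T then d else N.rev d
  let X : Finset D := (T ∪ T.image N.rev).filter fun d =>
    ψ (N.leftFace d) ≠ 0 ∧ ℓ (N.face d) ≠ ℓ d
  have hX : ∀ d ∈ X, base d ∈ T ∧ (d = base d ∨ d = N.rev (base d)) ∧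
      ψ (N.leftFace d) ≠ 0 ∧ ℓ (N.face d) ≠ ℓ d := by
    intro d hd
    obtain ⟨hd, hd'⟩ := mem_filter.mp hd
    by_cases h : d ∈ T
    · simp [base, h, hd'.1, hd'.2]
    · obtain ⟨b, hb, rfl⟩ := mem_image.mp ((mem_union.mp hd).resolve_left h)
      simp [base, h, hd'.1, hd'.2, N.rev_rev, hb]
  have hbase : ∀ d ∈ X, ∀ d' ∈ X, base d = base d' → d = d' := by
    intro d hd d' hd' h
    obtain ⟨a1, a2, a3, -⟩ := hX d hd
    obtain ⟨-, b2, b3, -⟩ := hX d' hd'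
    rw [← h] at b2
    have key : ∀ x y : ZMod 2, x + y = 1 → x ≠ 0 → y ≠ 0 → False := by decide
    rcases a2 with a2 | a2 <;> rcases b2 with b2 | b2
    · rw [a2, b2]
    · exact (key _ _ (h1 _ a1) (by rwa [← a2]) (by rwa [← b2])).elim
    · exact (key _ _ (h1 _ a1) (by rwa [← b2]) (by rwa [← a2])).elim
    · rw [a2, b2]
  have hjump : ∀ d, ∃ y, d ∈ X → base d ∉ T₀ → N.origin y = N.target (base d) ∧
      N.edgeOf y ∉ N.edgeOf '' T ∧ ℓ (N.next.symm y) ≠ ℓ y ∧ ψ (N.leftFace y) ≠ 0 ∧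
      N.origin y ∈ VC := by
    intro d
    by_cases hd : d ∈ X ∧ base d ∉ T₀
    swap
    · exact ⟨d, fun h1 h2 => absurd ⟨h1, h2⟩ hd⟩
    obtain ⟨a1, a2, a3, a4⟩ := hX d hd.1
    generalize base d = b at *
    obtain ⟨b', hb', ho, hl, hl', honly⟩ := hsucc b a1 hd.2
    have hV : N.target b ∈ VC := by
      rw [← ho]; exact hC.origin_mem _ ⟨b', hb', rfl⟩
    -- If the region is to the left of `b`, its sector runs counterclockwise from `b'` to `rev b`,
    -- with end labels `ℓ b' = ℓ b` and `ℓ (face b)`. If it is to the right, the sector runs from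
    -- `rev b` to `b'`, and `ℓ (next.symm b')` equals `ℓ (face (rev b))`.
    rcases a2 with rfl | rfl
    · obtain ⟨⟨y, y1, y2, y3, y4⟩, h5⟩ := exists_jump_between (ℓ := ℓ) hf (ψ := ψ) h2
        (p := b') (q := N.rev d) ho (fun e he => honly e (he.trans ho))
        (by rw [next_symm_rev, hl]; exact a4.symm)
      rw [next_symm_rev, leftFace_face] at h5
      rw [ho] at y1
      exact ⟨y, fun _ _ => ⟨y1, y2, y3, by rwa [y4, ← h5], y1 ▸ hV⟩⟩
    · obtain ⟨⟨y, y1, y2, y3, y4⟩, -⟩ := exists_jump_between (ℓ := ℓ) hf (ψ := ψ) h2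
        (p := N.rev b) (q := b') ho.symm (fun e he h => (honly e he h).symm)
        (by rw [hl', ← face_rev]; exact a4.symm)
      exact ⟨y, fun _ _ => ⟨y1, y2, y3, by rwa [y4], by rw [y1]; exact hV⟩⟩
  choose y hy using hjump
  let X₁ := X.filter fun d => base d ∉ T₀
  have hX₁ : ∀ d ∈ X₁, d ∈ X ∧ base d ∉ T₀ := fun d hd => mem_filter.mp hd
  have hcard : (X₁.image y).card = X₁.card := by
    refine card_image_of_injOn fun d hd d' hd' h => ?_
    obtain ⟨hd, hdT⟩ := hX₁ d hd
    obtain ⟨hd', hdT'⟩ := hX₁ d' hd'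
    refine hbase d hd d' hd' (hinj _ (hX d hd).1 hdT _ (hX d' hd').1 hdT' ?_)
    rw [← (hy d hd hdT).1, ← (hy d' hd' hdT').1, h]
  have hcard₀ : (X.filter fun d => ¬ base d ∉ T₀).card ≤ 2 := by
    refine le_trans (card_le_card_of_injOn base (fun d hd => ?_) fun d hd d' hd' h => ?_) hT₀
    · exact not_not.mp (mem_filter.mp hd).2
    · exact hbase d (mem_filter.mp hd).1 d' (mem_filter.mp hd').1 h
  have hsplit := card_filter_add_card_filter_not (s := X) (fun d => base d ∉ T₀)
  have := hN.card_vertexJumps_add_three_le hf hv hfc hC ψ hψ0 h2 X (X₁.image y)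
    (fun d hd h3 h4 => by
      refine mem_filter.mpr ⟨?_, h3, h4⟩
      obtain ⟨b, hb, h⟩ := hd
      rw [mem_union, mem_image]
      rcases edgeOf_eq_edgeOf.mp h with rfl | rfl
      · exact Or.inl hb
      · exact Or.inr ⟨b, hb, rfl⟩)
    (fun e he => by
      obtain ⟨d, hd, rfl⟩ := mem_image.mp he
      obtain ⟨hd, hdT⟩ := hX₁ d hd
      obtain ⟨-, y2, y3, y4, y5⟩ := hy d hd hdT
      exact ⟨y2, y4, y5, y3⟩)
  have e : X₁.card = (X.filter fun d => base d ∉ T₀).card := rfl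
  omega

/-- A walk along outgoing darts of one colour. -/
structure IsStraight (N : CombinatorialMap D) (ℓ : D → ZMod 3) (P : ℕ → D) : Prop where
  origin_succ : ∀ n, N.origin (P (n + 1)) = N.target (P n)
  label_succ : ∀ n, ℓ (P (n + 1)) = ℓ (P n)
  out : ∀ n, ℓ (N.next.symm (P n)) + 1 = ℓ (P n)

namespace IsStraight

variable {P Q : ℕ → D}

theorem shift (h : N.IsStraight ℓ P) (k : ℕ) : N.IsStraight ℓ fun n => P (k + n) where
  origin_succ n := h.origin_succ (k + n)
  label_succ n := h.label_succ (k + n)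
  out n := h.out (k + n)

theorem boundary_sum (h : N.IsStraight ℓ P) (n : ℕ) :
    ∑ i ∈ range n, N.boundary (Finsupp.single (N.edgeOf (P i)) 1) =
      Finsupp.single (N.origin (P n)) 1 + Finsupp.single (N.origin (P 0)) 1 := by
  induction n with
  | zero => exact (ZModModule.add_self _).symm
  | succ n ih =>
    rw [sum_range_succ, ih, boundary_single, ← h.origin_succ]
    have := ZModModule.add_self (Finsupp.single (N.origin (P n)) (1 : ZMod 2))
    calc _ = Finsupp.single (N.origin (P (n + 1))) 1 + Finsupp.single (N.origin (P 0)) 1 +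
          (Finsupp.single (N.origin (P n)) (1 : ZMod 2) +
            Finsupp.single (N.origin (P n)) 1) := by abel
      _ = _ := by rw [this, add_zero]

/-- Backtracking would put the label `c - 1` at `face (P n)`, right after the label `c` at `P n`,
but along a face labels rise by `0` or `1`. -/
theorem succ_ne_rev (h : N.IsStraight ℓ P) (hfc : IsWinding N.face ℓ)
    (n : ℕ) : P (n + 1) ≠ N.rev (P n) := by
  intro hr
  have h1 := h.label_succ n
  have h2 := h.out (n + 1)
  rw [hr] at h1 h2
  rw [next_symm_rev] at h2
  rw [h1] at h2
  rcases hfc.step (P n) with h3 | h3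
  · rw [h3] at h2; simp at h2
  · rw [h3] at h2
    generalize ℓ (P n) = x at h2
    revert x; decide

/-- Two straight walks with the same ends do not enclose a region. -/
theorem false_of_bigon (hP : N.IsStraight ℓ P) (hQ : N.IsStraight ℓ Q) (hN : N.IsAcyclic)
    (hf : N.IsLocallyFinite) (hv : IsWinding N.next ℓ) (hfc : IsWinding N.face ℓ) {a b : ℕ}
    (ha : 0 < a) (h0 : N.origin (P 0) = N.origin (Q 0)) (hab : N.origin (P a) = N.origin (Q b))
    (hPP : ∀ i j, 0 < i → i < a → j ≤ a → N.origin (P i) = N.origin (P j) → i = j)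
    (hQQ : ∀ i j, 0 < i → i < b → j ≤ b → N.origin (Q i) = N.origin (Q j) → i = j)
    (hPQ : ∀ i j, 0 < i → i < a → j ≤ b → N.origin (P i) ≠ N.origin (Q j))
    (hQP : ∀ i j, 0 < i → i < b → j ≤ a → N.origin (Q i) ≠ N.origin (P j))
    (hne : 0 < b → P 0 ≠ Q 0) (hr : 0 < b → P 0 ≠ N.rev (Q 0)) : False := by
  classical
  -- If an edge were used in both directions, simplicity would force either immediate backtracking
  -- or both `i = j + 1` and `j = i + 1`.
  have self : ∀ {R : ℕ → D} {c : ℕ}, N.IsStraight ℓ R →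
      (∀ i j, 0 < i → i < c → j ≤ c → N.origin (R i) = N.origin (R j) → i = j) →
      ∀ i j, i < c → j < c → R i ≠ N.rev (R j) := by
    intro R c hR hRR i j hi hj h
    have e1 : N.origin (R i) = N.origin (R (j + 1)) := by rw [hR.origin_succ, h]; rfl
    have e2 : N.origin (R j) = N.origin (R (i + 1)) := by rw [hR.origin_succ, h, target_rev]
    rcases Nat.eq_zero_or_pos i with rfl | hi0 <;> rcases Nat.eq_zero_or_pos j with rfl | hj0
    · exact N.rev_ne _ h.symm
    · have := hRR j _ hj0 hj (by omega) e2
      subst this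
      exact hR.succ_ne_rev hfc 0 (by rw [h, N.rev_rev])
    · have := hRR i _ hi0 hi (by omega) e1
      subst this
      exact hR.succ_ne_rev hfc 0 h
    · have := hRR i _ hi0 hi (by omega) e1
      have := hRR j _ hj0 hj (by omega) e2
      omega
  have cross : ∀ i j, i < a → j < b → P i ≠ N.rev (Q j) := by
    intro i j hi hj h
    have e1 : N.origin (P i) = N.origin (Q (j + 1)) := by rw [hQ.origin_succ, h]; rfl
    have e2 : N.origin (Q j) = N.origin (P (i + 1)) := by rw [hP.origin_succ, h, target_rev]
    rcases Nat.eq_zero_or_pos i with rfl | hi0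
    · rcases Nat.eq_zero_or_pos j with rfl | hj0
      · exact hr hj h
      · exact hQP j _ hj0 hj (by omega) e2
    · exact hPQ i _ hi0 hi (by omega) e1
  have inj : ∀ {R : ℕ → D} {c : ℕ},
      (∀ i j, 0 < i → i < c → j ≤ c → N.origin (R i) = N.origin (R j) → i = j) →
      ∀ i j, i < c → j < c → R i = R j → i = j := by
    intro R c hRR i j hi hj h
    rcases Nat.eq_zero_or_pos i with rfl | hi0
    · rcases Nat.eq_zero_or_pos j with rfl | hj0
      · rfl
      · exact (hRR j 0 hj0 hj (by omega) (by rw [h])).symm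
    · exact hRR i j hi0 hi (by omega) (by rw [h])
  have hdisj : ∀ i j, i < a → j < b → P i ≠ Q j := by
    intro i j hi hj h
    rcases Nat.eq_zero_or_pos i with rfl | hi0
    · rcases Nat.eq_zero_or_pos j with rfl | hj0
      · exact hne hj h
      · exact hQP j 0 hj0 hj (by omega) (by rw [h])
    · exact hPQ i j hi0 hi (by omega) (by rw [h])
  have disj : Disjoint ((range a).image P) ((range b).image Q) := by
    rw [disjoint_left]
    intro d h h'
    obtain ⟨i, hi, rfl⟩ := mem_image.mp h
    obtain ⟨j, hj, hij⟩ := mem_image.mp h'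
    exact hdisj i j (mem_range.mp hi) (mem_range.mp hj) hij.symm
  obtain ⟨T, hT⟩ : ∃ T, T = (range a).image P ∪ (range b).image Q := ⟨_, rfl⟩
  have hmem : ∀ d, d ∈ T ↔ (∃ i < a, P i = d) ∨ ∃ j < b, Q j = d := by
    simp [hT]
  have hmemP : ∀ i < a, P i ∈ T := fun i hi =>
    (hmem _).mpr (Or.inl ⟨i, hi, rfl⟩)
  have hmemQ : ∀ j < b, Q j ∈ T := fun j hj =>
    (hmem _).mpr (Or.inr ⟨j, hj, rfl⟩)
  have honly : ∀ d, N.edgeOf d ∈ N.edgeOf '' T →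
      (∃ i < a, d = P i ∨ d = N.rev (P i)) ∨ ∃ j < b, d = Q j ∨ d = N.rev (Q j) := by
    rintro d ⟨e, he, h⟩
    rcases (hmem _).mp he with ⟨i, hi, rfl⟩ | ⟨i, hi, rfl⟩
    · exact Or.inl ⟨i, hi, edgeOf_eq_edgeOf.mp h⟩
    · exact Or.inr ⟨i, hi, edgeOf_eq_edgeOf.mp h⟩
  have hpath : ∀ {R : ℕ → D} {c : ℕ}, N.IsStraight ℓ R →
      (∀ i < c, R i ∈ T) → ∀ i ≤ c,
      ∃ z : N.Edge →₀ ZMod 2,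
        (∀ e, z e ≠ 0 → e ∈ N.edgeOf '' T) ∧
        N.boundary z =
          Finsupp.single (N.origin (R i)) 1 + Finsupp.single (N.origin (R 0)) 1 := by
    intro R c hR hRm i hi
    refine ⟨∑ j ∈ range i, Finsupp.single (N.edgeOf (R j)) 1, fun e he => ?_, ?_⟩
    · rw [Finsupp.finsetSum_apply] at he
      obtain ⟨j, hj, hje⟩ := exists_ne_zero_of_sum_ne_zero he
      rw [Finsupp.single_apply] at hje
      exact ⟨R j, hRm j ((mem_range.mp hj).trans_le hi), by by_contra h; simp [h] at hje⟩
    · rw [map_sum, hR.boundary_sum]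
  -- The exceptional darts are the last ones of the two sides, which need not continue straight. For
  -- `b = 0` the frontier is a single closed walk, and the second entry is harmless.
  refine hN.false_of_straight_frontier hf hv hfc
    T {P (a - 1), Q (b - 1)} card_le_two ⟨P 0, hmemP 0 ha⟩
    (VC := {v | (∃ i ≤ a, N.origin (P i) = v) ∨ ∃ j ≤ b, N.origin (Q j) = v}) ?_ ?_ ⟨?_, ?_⟩ ?_ ?_
  · intro d hd hd'
    rcases (hmem _).mp hd with ⟨i, hi, rfl⟩ | ⟨i, hi, rfl⟩ <;>
      rcases (hmem _).mp hd' with ⟨j, hj, h⟩ | ⟨j, hj, h⟩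
    · exact self hP hPP j i hj hi h
    · exact cross i j hi hj (by rw [h, N.rev_rev])
    · exact cross j i hj hi h
    · exact self hQ hQQ j i hj hi h
  · rw [hT, sum_union disj, sum_image (fun i hi j hj => inj hPP i j (mem_range.mp hi) (mem_range.mp hj)),
      sum_image (fun i hi j hj => inj hQQ i j (mem_range.mp hi) (mem_range.mp hj)),
      hP.boundary_sum, hQ.boundary_sum, h0, hab]
    exact ZModModule.add_self _
  · intro d hd
    rcases honly d hd with ⟨i, hi, rfl | rfl⟩ | ⟨i, hi, rfl | rfl⟩
    · exact Or.inl ⟨i, hi.le, rfl⟩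
    · exact Or.inl ⟨i + 1, hi, hP.origin_succ i⟩
    · exact Or.inr ⟨i, hi.le, rfl⟩
    · exact Or.inr ⟨i + 1, hi, hQ.origin_succ i⟩
  · refine ⟨N.origin (P 0), ?_⟩
    rintro w (⟨i, hi, rfl⟩ | ⟨i, hi, rfl⟩)
    · exact hpath hP hmemP i hi
    · rw [h0]; exact hpath hQ hmemQ i hi
  · intro d hd hd0
    simp only [mem_insert, mem_singleton, not_or] at hd0
    rcases (hmem _).mp hd with ⟨i, hi, rfl⟩ | ⟨i, hi, rfl⟩
    · have hi1 : i + 1 < a := by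
        by_contra h
        exact hd0.1 (by rw [show i = a - 1 by omega])
      refine ⟨P (i + 1), hmemP _ hi1, hP.origin_succ i, hP.label_succ i, ?_, ?_⟩
      · have := hP.out i
        have h2 := hP.out (i + 1)
        rw [hP.label_succ, ← this] at h2
        exact add_right_cancel h2
      · intro e he heC
        rw [← hP.origin_succ] at he
        rcases honly e heC with ⟨j, hj, rfl | rfl⟩ | ⟨j, hj, rfl | rfl⟩
        · left; rw [hPP (i + 1) j (by omega) hi1 hj.le he.symm]
        · right
          have := hPP (i + 1) (j + 1) (by omega) hi1 hj (he.symm.trans (hP.origin_succ j).symm)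
          rw [Nat.succ_injective this]
        · exact (hPQ (i + 1) j (by omega) hi1 hj.le he.symm).elim
        · exact (hPQ (i + 1) (j + 1) (by omega) hi1 hj
            (he.symm.trans (hQ.origin_succ j).symm)).elim
    · have hi1 : i + 1 < b := by
        by_contra h
        exact hd0.2 (by rw [show i = b - 1 by omega])
      refine ⟨Q (i + 1), hmemQ _ hi1, hQ.origin_succ i, hQ.label_succ i, ?_, ?_⟩
      · have := hQ.out i
        have h2 := hQ.out (i + 1)
        rw [hQ.label_succ, ← this] at h2
        exact add_right_cancel h2
      · intro e he heC
        rw [← hQ.origin_succ] at he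
        rcases honly e heC with ⟨j, hj, rfl | rfl⟩ | ⟨j, hj, rfl | rfl⟩
        · exact (hQP (i + 1) j (by omega) hi1 hj.le he.symm).elim
        · exact (hQP (i + 1) (j + 1) (by omega) hi1 hj
            (he.symm.trans (hP.origin_succ j).symm)).elim
        · left; rw [hQQ (i + 1) j (by omega) hi1 hj.le he.symm]
        · right
          have := hQQ (i + 1) (j + 1) (by omega) hi1 hj (he.symm.trans (hQ.origin_succ j).symm)
          rw [Nat.succ_injective this]
  · intro d hd hd0 d' hd' hd0' h
    simp only [mem_insert, mem_singleton, not_or] at hd0 hd0'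
    rcases (hmem _).mp hd with ⟨i, hi, rfl⟩ | ⟨i, hi, rfl⟩ <;>
      rcases (hmem _).mp hd' with ⟨j, hj, rfl⟩ | ⟨j, hj, rfl⟩
    · have hi1 : i + 1 < a := by
        by_contra h
        exact hd0.1 (by rw [show i = a - 1 by omega])
      rw [← hP.origin_succ, ← hP.origin_succ] at h
      rw [Nat.succ_injective (hPP (i + 1) (j + 1) (by omega) hi1 hj h)]
    · have hi1 : i + 1 < a := by
        by_contra h
        exact hd0.1 (by rw [show i = a - 1 by omega])
      rw [← hP.origin_succ, ← hQ.origin_succ] at h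
      exact (hPQ (i + 1) (j + 1) (by omega) hi1 hj h).elim
    · have hi1 : i + 1 < b := by
        by_contra h
        exact hd0.2 (by rw [show i = b - 1 by omega])
      rw [← hP.origin_succ, ← hQ.origin_succ] at h
      exact (hQP (i + 1) (j + 1) (by omega) hi1 hj h).elim
    · have hi1 : i + 1 < b := by
        by_contra h
        exact hd0.2 (by rw [show i = b - 1 by omega])
      rw [← hQ.origin_succ, ← hQ.origin_succ] at h
      rw [Nat.succ_injective (hQQ (i + 1) (j + 1) (by omega) hi1 hj h)]

end IsStraight


/-! ### Disjoint straight rays and 3-connectivity -/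

variable {D : Type u} {N : CombinatorialMap D} {ℓ : D → ZMod 3}

namespace IsStraight

variable {P Q : ℕ → D}

/-- The first repeated vertex cuts out a simple closed straight walk, a bigon with one side of
length `0`. -/
theorem origin_injective (hP : N.IsStraight ℓ P) (hN : N.IsAcyclic)
    (hf : N.IsLocallyFinite) (hv : IsWinding N.next ℓ) (hfc : IsWinding N.face ℓ) :
    Injective fun n => N.origin (P n) := by
  classical
  by_contra hinj
  have hex : ∃ j, ∃ i < j, N.origin (P i) = N.origin (P j) := by
    simp only [Injective] at hinj
    push Not at hinj
    obtain ⟨i, j, h, hij⟩ := hinj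
    rcases lt_or_gt_of_ne hij with hlt | hlt
    · exact ⟨j, i, hlt, h⟩
    · exact ⟨i, j, hlt, h.symm⟩
  obtain ⟨j, ⟨i, hij, h⟩, hmin⟩ : ∃ j, (∃ i < j, N.origin (P i) = N.origin (P j)) ∧
      ∀ k < j, ¬ ∃ i < k, N.origin (P i) = N.origin (P k) :=
    ⟨Nat.find hex, Nat.find_spec hex, fun k hk => Nat.find_min hex hk⟩
  obtain ⟨a, rfl⟩ := Nat.exists_eq_add_of_lt hij
  have hne : ∀ k l, k < l → l < a + 1 → N.origin (P (i + k)) ≠ N.origin (P (i + l)) :=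
    fun k l hkl hl hkl' => hmin (i + l) (by omega) ⟨i + k, by omega, hkl'⟩
  have h0 : ∀ k, 0 < k → k < a + 1 → N.origin (P (i + k)) ≠ N.origin (P (i + 0)) :=
    fun k hk hk' e => hne 0 k hk hk' e.symm
  refine (hP.shift i).false_of_bigon (hP.shift i) hN hf hv hfc (a := a + 1) (b := 0)
    (by omega) rfl h.symm ?_ ?_ ?_ ?_ (fun h => absurd h (lt_irrefl 0))
    (fun h => absurd h (lt_irrefl 0))
  · intro k l hk hka hl hkl
    rcases Nat.lt_or_ge l (a + 1) with hla | hla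
    · rcases lt_trichotomy k l with hlt | rfl | hlt
      · exact (hne k l hlt hla hkl).elim
      · rfl
      · exact (hne l k hlt hka hkl.symm).elim
    · obtain rfl : l = a + 1 := le_antisymm hl hla
      exact (h0 k hk hka (hkl.trans h.symm)).elim
  · intro k l hk hk'; omega
  · intro k l hk hka hl
    obtain rfl : l = 0 := by omega
    exact h0 k hk hka
  · intro k l hk hk'; omega

/-- Otherwise the first vertex after the start where `P` meets `Q` cuts out a bigon, whose sides are
simple by `origin_injective`. -/
theorem eq_zero_of_origin_eq (hP : N.IsStraight ℓ P) (hQ : N.IsStraight ℓ Q) (hN : N.IsAcyclic)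
    (hf : N.IsLocallyFinite) (hv : IsWinding N.next ℓ) (hfc : IsWinding N.face ℓ)
    (h0 : N.origin (P 0) = N.origin (Q 0)) (hne : P 0 ≠ Q 0) {i j : ℕ}
    (hij : N.origin (P i) = N.origin (Q j)) : i = 0 := by
  classical
  have hPi := hP.origin_injective hN hf hv hfc
  have hQi := hQ.origin_injective hN hf hv hfc
  by_contra hi
  have hex : ∃ a, 0 < a ∧ ∃ b, N.origin (P a) = N.origin (Q b) := ⟨i, Nat.pos_of_ne_zero hi, j, hij⟩
  obtain ⟨a, ⟨ha, b, hab⟩, hmin⟩ : ∃ a, (0 < a ∧ ∃ b, N.origin (P a) = N.origin (Q b)) ∧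
      ∀ k < a, ¬ (0 < k ∧ ∃ b, N.origin (P k) = N.origin (Q b)) :=
    ⟨Nat.find hex, Nat.find_spec hex, fun k hk => Nat.find_min hex hk⟩
  have hb : 0 < b := by
    rcases Nat.eq_zero_or_pos b with rfl | hb
    · exact absurd (hPi (hab.trans h0.symm)) ha.ne'
    · exact hb
  refine hP.false_of_bigon hQ hN hf hv hfc ha h0 hab (fun k l _ _ _ h => hPi h)
    (fun k l _ _ _ h => hQi h) (fun k l hk hka _ h => hmin k hka ⟨hk, l, h⟩) ?_
    (fun _ => hne) ?_
  · intro k l hk hkb hl h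
    rcases Nat.lt_or_ge l a with hla | hla
    · rcases Nat.eq_zero_or_pos l with rfl | hl0
      · exact hk.ne' (hQi (h.trans h0))
      · exact hmin l hla ⟨hl0, k, h.symm⟩
    · obtain rfl : l = a := le_antisymm hl hla
      exact hkb.ne (hQi (h.trans hab))
  · intro _ h
    have e : N.origin (P 0) = N.origin (Q 1) := by rw [hQ.origin_succ, h]; rfl
    exact absurd (hQi (h0.symm.trans e)) (by omega)

end IsStraight

theorem exists_out_dart (hf : N.IsLocallyFinite) (hv : IsWinding N.next ℓ) (v : N.Vertex)
    (c : ZMod 3) : ∃ d, N.origin d = v ∧ ℓ d = c ∧ ℓ (N.next.symm d) + 1 = c := by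
  obtain ⟨d, rfl⟩ := exists_origin v
  obtain ⟨y, hy, h1, h2⟩ := hv.exists_jump hf.next d (c - 1)
  refine ⟨N.next y, ?_, by rw [h2, sub_add_cancel], ?_⟩
  · rw [origin_next, origin_eq_origin]; exact hy.symm
  · rw [Equiv.symm_apply_apply, h1, sub_add_cancel]

theorem exists_isStraight (hf : N.IsLocallyFinite) (hv : IsWinding N.next ℓ) (v : N.Vertex)
    (c : ZMod 3) : ∃ P, N.IsStraight ℓ P ∧ N.origin (P 0) = v ∧ ℓ (P 0) = c := by
  choose s h1 h2 h3 using fun w => exists_out_dart hf hv w c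
  let P : ℕ → D := fun n => Nat.rec (s v) (fun _ d => s (N.target d)) n
  have hl : ∀ n, ℓ (P n) = c := by rintro (_ | n) <;> exact h2 _
  refine ⟨P, ⟨fun n => h1 _, fun n => (hl (n + 1)).trans (hl n).symm, ?_⟩, h1 v, hl 0⟩
  intro n
  rw [hl]
  rcases n with _ | n <;> exact h3 _

/-- The three rays from `v`, one per colour, meet only at `v`, which is not in `S`. If each of them
met `S`, two would do so at the same vertex. -/
theorem exists_isStraight_avoiding (hN : N.IsAcyclic) (hf : N.IsLocallyFinite)
    (hv : IsWinding N.next ℓ) (hfc : IsWinding N.face ℓ) (S : Finset N.Vertex)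
    (hS : S.card ≤ 2) {v : N.Vertex} (hvS : v ∉ S) :
    ∃ P, N.IsStraight ℓ P ∧ N.origin (P 0) = v ∧ ∀ n, N.origin (P n) ∉ S := by
  choose P hP h0 hc using fun c => exists_isStraight (ℓ := ℓ) hf hv v c
  by_contra! hno
  choose n hn using fun c => hno (P c) (hP c) (h0 c)
  obtain ⟨c, -, c', -, hcc, h⟩ := exists_ne_map_eq_of_card_lt_of_maps_to
    (s := (univ : Finset (ZMod 3))) (t := S) (f := fun c => N.origin (P c (n c)))
    (by simpa using Nat.lt_succ_of_le hS) (fun c _ => hn c)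
  have := (hP c).eq_zero_of_origin_eq (hP c') hN hf hv hfc ((h0 c).trans (h0 c').symm)
    (fun e => hcc (by rw [← hc c, e, hc])) h
  refine hvS ?_
  rw [← h0 c, ← this]
  exact hn c

/-- Every component left by the deletion of `S` contains a ray to infinity, and one-endedness leaves
room for only one such component. Any one ray shows that there are infinitely many vertices. -/
theorem isKConnected_three [Nonempty D] (hN : N.IsAcyclic) (hf : N.IsLocallyFinite)
    (hconst : ∀ f : N.Vertex → ZMod 2, (∀ d, f (N.target d) = f (N.origin d)) →
      ∀ v w, f v = f w)
    (hv : IsWinding N.next ℓ) (hfc : IsWinding N.face ℓ) : IsKConnected N.graph 3 := by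
  classical
  have v₀ : N.Vertex := N.origin (Classical.arbitrary D)
  obtain ⟨P, hP, -, -⟩ := exists_isStraight (ℓ := ℓ) hf hv v₀ 0
  have : Infinite N.Vertex := Infinite.of_injective _ (hP.origin_injective hN hf hv hfc)
  refine ⟨by simp, fun S hS => ?_⟩
  obtain ⟨w, hw⟩ := Infinite.exists_notMem_finset S
  have : Nonempty {v | v ∉ S} := ⟨⟨w, hw⟩⟩
  refine ⟨fun u w => ?_⟩
  by_contra huw
  let G := N.graph.induce {v | v ∉ S}
  let f : N.Vertex → ZMod 2 := fun x =>
    if ∃ h : x ∉ S, G.Reachable u ⟨x, h⟩ then 1 else 0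
  have hadj : ∀ d (h : N.origin d ∉ S) (h' : N.target d ∉ S),
      G.Reachable ⟨N.origin d, h⟩ ⟨N.target d, h'⟩ := by
    intro d h h'
    by_cases he : N.origin d = N.target d
    · simp only [he]; exact SimpleGraph.Reachable.refl _
    · exact SimpleGraph.Adj.reachable
        (show N.graph.Adj (N.origin d) (N.target d) from ⟨he, d, rfl, rfl⟩)
  have hf1 : ∀ d, N.origin d ∉ S → N.target d ∉ S → f (N.origin d) = f (N.target d) := by
    intro d h h'
    refine if_congr ⟨fun ⟨_, hr⟩ => ⟨h', hr.trans (hadj d h h')⟩,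
      fun ⟨_, hr⟩ => ⟨h, hr.trans (hadj d h h').symm⟩⟩ rfl rfl
  have hreach : ∀ (P : ℕ → D), N.IsStraight ℓ P → (hPS : ∀ n, N.origin (P n) ∉ S) →
      ∀ n, f (N.origin (P n)) = f (N.origin (P 0)) := by
    intro P hP hPS n
    induction n with
    | zero => rfl
    | succ n ih =>
      rw [← ih, hP.origin_succ]
      exact (hf1 _ (hPS n) (hP.origin_succ n ▸ hPS (n + 1))).symm
  have hstar : {d | N.origin d ∈ S}.Finite := by
    refine (S.finite_toSet.biUnion fun v _ => (orbitFinset N.next v.out).finite_toSet).subset ?_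
    intro d hd
    simp only [Set.mem_iUnion, mem_coe]
    refine ⟨N.origin d, hd, ?_⟩
    rw [mem_orbitFinset (hf.next _), ← origin_eq_origin]
    exact Quotient.out_eq _
  -- The indicator `f` of the component of `u` changes only along darts with an end in `S`, and
  -- these are finitely many.
  obtain ⟨g, hg⟩ := hN.exists_finsupp_coboundary hf f (by
    refine (hstar.union (hstar.image N.rev)).subset fun d hd => ?_
    by_contra hno
    simp only [Set.mem_union, not_or] at hno
    exact hd (hf1 d hno.1 fun h => hno.2 ⟨N.rev d, h, N.rev_rev d⟩))
  -- `f` is constant along a ray from `v` that avoids `S`, and the ray leaves the finite support of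
  -- `g`.
  have hval : ∀ v, v ∉ S → ∃ x, f x + g x = f v := by
    intro v hvS
    obtain ⟨P, hP, hP0, hPS⟩ := exists_isStraight_avoiding (ℓ := ℓ) hN hf hv hfc S (by omega) hvS
    have hinj := hP.origin_injective hN hf hv hfc
    obtain ⟨n, hn⟩ : ∃ n, N.origin (P n) ∉ g.support := by
      by_contra! h
      exact Set.infinite_of_injective_forall_mem hinj h g.support.finite_toSet
    refine ⟨N.origin (P n), ?_⟩
    rw [Finsupp.notMem_support_iff.mp hn, add_zero, hreach P hP hPS, hP0]
  obtain ⟨x, hx⟩ := hval u u.2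
  obtain ⟨y, hy⟩ := hval w w.2
  have h1 : f u = 1 := if_pos ⟨u.2, SimpleGraph.Reachable.refl _⟩
  have h2 : f w = 0 := if_neg fun ⟨_, h⟩ => huw h
  have := hconst (fun x => f x + g x) hg x y
  simp only [hx, hy, h1, h2] at this
  exact one_ne_zero this

end CombinatorialMap

/-! ### From cyclic types to winding labels -/

/-- Used with `n + 1 = 3 * k`: the first label `0` and the last label `n` give the step that closes
the cycle, and the presence of the labels `0` and `1` shows that the cycle is not constant. -/
theorem isChain_flatten_replicate (n : ℕ) (len : Fin (n + 1) → ℕ) (hlen : ∀ j, 0 < len j) :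
    let l := (List.ofFn fun j : Fin (n + 1) =>
      List.replicate (len j) ((j : ℕ) : ZMod 3)).flatten
    l.IsChain (fun a b => b = a ∨ b = a + 1) ∧ l.head? = some 0 ∧
      l.getLast? = some (n : ZMod 3) ∧ ∀ j ≤ n, (j : ZMod 3) ∈ l := by
  induction n with
  | zero =>
    have h0 := (hlen 0).ne'
    have e : (List.ofFn fun j : Fin (0 + 1) =>
        List.replicate (len j) ((j : ℕ) : ZMod 3)).flatten = List.replicate (len 0) 0 := by simp
    simp only [e]
    refine ⟨List.isChain_replicate_of_rel _ (Or.inl rfl), ?_, ?_, ?_⟩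
    · simp [List.head?_replicate, h0]
    · simp [List.getLast?_replicate, h0]
    · intro j hj
      obtain rfl : j = 0 := by omega
      simp [h0]
  | succ n ih =>
    have e : (List.ofFn fun j : Fin (n + 1 + 1) =>
        List.replicate (len j) ((j : ℕ) : ZMod 3)).flatten =
        (List.ofFn fun j : Fin (n + 1) =>
          List.replicate (len j.castSucc) ((j : ℕ) : ZMod 3)).flatten ++
        List.replicate (len (Fin.last _)) ((n + 1 : ℕ) : ZMod 3) := by
      rw [List.ofFn_succ', List.concat_eq_append, List.flatten_append]
      simp
    obtain ⟨h1, h2, h3, h4⟩ := ih (fun j => len j.castSucc) fun j => hlen _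
    have h0 := (hlen (Fin.last (n + 1))).ne'
    simp only [e]
    refine ⟨List.isChain_append.mpr ⟨h1, List.isChain_replicate_of_rel _ (Or.inl rfl), ?_⟩,
      ?_, ?_, ?_⟩
    · intro x hx y hy
      rw [h3] at hx
      rw [List.head?_replicate, if_neg h0] at hy
      simp only [Option.mem_def, Option.some.injEq] at hx hy
      right
      rw [← hx, ← hy]
      push_cast
      rfl
    · rw [List.head?_append, h2]; rfl
    · rw [List.getLast?_append, List.getLast?_replicate, if_neg h0]; rfl
    · intro j hj
      rw [List.mem_append]
      rcases Nat.lt_or_ge n j with h | h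
      · obtain rfl : j = n + 1 := by omega
        exact Or.inr (List.mem_replicate.mpr ⟨h0, rfl⟩)
      · exact Or.inl (h4 j h)

theorem isWinding_of_hasCyclicType {α : Type*} {π : Equiv.Perm α} {ℓ : α → ZMod 3}
    (hπ : ∀ x, x ∈ periodicPts π)
    (h : ∀ c : PermOrbit π, ∃ k, 1 ≤ k ∧ HasCyclicType π ℓ c k) : IsWinding π ℓ := by
  have key : ∀ y, ∃ x, π.SameCycle x y ∧
      (∀ m < minimalPeriod π x, ℓ ((π ^ (m + 1)) x) = ℓ ((π ^ m) x) ∨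
        ℓ ((π ^ (m + 1)) x) = ℓ ((π ^ m) x) + 1) ∧
      ∃ m m', ℓ ((π ^ m) x) ≠ ℓ ((π ^ m') x) := by
    intro y
    obtain ⟨k, hk, hc⟩ := h (Quotient.mk _ y)
    rw [HasCyclicType, if_neg (by omega)] at hc
    obtain ⟨x, hx, len, hlen, hl⟩ := hc
    have hp := minimalPeriod_pos_of_mem_periodicPts (hπ x)
    obtain ⟨n, hn⟩ : ∃ n, 3 * k = n + 1 := ⟨3 * k - 1, by omega⟩
    have hn3 : (n : ZMod 3) + 1 = 0 := by
      have : ((3 * k : ℕ) : ZMod 3) = ((n + 1 : ℕ) : ZMod 3) := by rw [hn]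
      push_cast at this
      rw [← this, show (3 : ZMod 3) = 0 from rfl, zero_mul]
    have hn2 : 2 ≤ n := by omega
    revert len
    rw [hn]
    intro len hlen hl
    obtain ⟨h1, h2, h3, h4⟩ := isChain_flatten_replicate n len hlen
    rw [← hl] at h1 h2 h3 h4
    refine ⟨x, Quotient.exact (s := Equiv.Perm.SameCycle.setoid π) hx, ?_, ?_⟩
    · intro m hm
      rcases Nat.lt_or_ge (m + 1) (minimalPeriod π x) with hm' | hm'
      · rw [List.isChain_iff_getElem] at h1
        have e : ∀ (i : ℕ) (hi : i < ((List.range (minimalPeriod π x)).map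
            fun m => ℓ ((π ^ m) x)).length), ((List.range (minimalPeriod π x)).map
            fun m => ℓ ((π ^ m) x))[i] = ℓ ((π ^ i) x) := fun i hi => by simp
        have h5 := h1 m (by simpa using hm')
        rwa [e, e] at h5
      -- The closing step leads from the last interval, with label `n = -1`, back to the label `0`.
      · have hm'' : minimalPeriod π x = m + 1 := by omega
        right
        rw [hm''] at h2 h3
        have e : (π ^ (m + 1)) x = x := by
          rw [← hm'', ← Equiv.Perm.iterate_eq_pow, iterate_minimalPeriod]
        have e0 : ℓ x = 0 := by
          rw [List.range_succ_eq_map] at h2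
          simpa using h2
        have e1 : ℓ ((π ^ m) x) = n := by
          rw [List.range_succ] at h3
          simpa using h3
        rw [e, e0, e1, hn3]
    · obtain ⟨m, -, hm⟩ := List.mem_map.mp (h4 0 (by omega))
      obtain ⟨m', -, hm'⟩ := List.mem_map.mp (h4 1 (by omega))
      refine ⟨m, m', ?_⟩
      rw [hm, hm']
      simp
  constructor
  · intro y
    obtain ⟨x, hxy, hs, -⟩ := key y
    obtain ⟨m, hm, rfl⟩ := (sameCycle_iff_exists_lt_minimalPeriod (hπ x)).mp hxy
    have := hs m hm
    rwa [pow_succ', Equiv.Perm.mul_apply] at this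
  · intro y
    obtain ⟨x, hxy, -, m, m', hmm⟩ := key y
    by_contra! hno
    have : ∀ m : ℕ, ℓ ((π ^ m) x) = ℓ x := by
      intro m
      induction m with
      | zero => rfl
      | succ m ih =>
        rw [pow_succ', Equiv.Perm.mul_apply,
          hno _ (hxy.symm.trans ⟨m, by rw [zpow_natCast]⟩), ih]
    exact hmm ((this m).trans (this m').symm)

/-! ### Lifting the labels to the universal cover, and the theorem -/

namespace CombinatorialMap

variable {D : Type u} [Finite D] {M : CombinatorialMap D} {v₀ : M.Vertex} {ℓ : D → ZMod 3}

theorem isWinding_universalCover_next (h : IsWinding M.next ℓ) :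
    IsWinding (M.universalCover v₀).next fun p => ℓ p.1.2 where
  step p := h.step p.1.2
  jump p := by
    obtain ⟨y, hy, hj⟩ := h.jump p.1.2
    obtain ⟨m, -, rfl⟩ := (sameCycle_iff_exists_lt_minimalPeriod
      (M.next.injective.mem_periodicPts _)).mp hy
    refine ⟨((M.universalCover v₀).next ^ m) p, ⟨m, by rw [zpow_natCast]⟩, ?_⟩
    have e := congrArg Prod.snd (universalCover_next_pow_val p m)
    change ℓ (M.next _) ≠ ℓ _
    rw [e]
    exact hj

theorem isWinding_universalCover_face (h : IsWinding M.face ℓ) :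
    IsWinding (M.universalCover v₀).face fun p => ℓ p.1.2 where
  step p := h.step p.1.2
  jump p := by
    obtain ⟨y, hy, hj⟩ := h.jump p.1.2
    obtain ⟨m, -, rfl⟩ := (sameCycle_iff_exists_lt_minimalPeriod
      (M.face.injective.mem_periodicPts _)).mp hy
    refine ⟨((M.universalCover v₀).face ^ m) p, ⟨m, by rw [zpow_natCast]⟩, ?_⟩
    have e := congrArg Prod.snd (universalCover_face_pow_val p m)
    change ℓ (M.face _) ≠ ℓ _
    rw [e]
    exact hj

end CombinatorialMap

theorem theorem2p7 {D : Type*} [Finite D] (M : CombinatorialMap D)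
    (hconn : M.graph.Connected) (g : ℕ) (hg : 1 ≤ g) (hgenus : M.HasGenus g)
    (ℓ : D → ZMod 3)
    (hEdge : M.IsEdgeLabeling Set.univ ℓ)
    (hVertex : M.IsVertexLabeling {k | 1 ≤ k} ℓ)
    (hFace : M.IsFaceLabeling {k | 1 ≤ k} ℓ) :
    M.IsEssentiallyKConnected 3 := by
  intro v₀
  obtain ⟨f, hf, hfℓ⟩ := hVertex
  obtain ⟨f', hf', hfℓ'⟩ := hFace
  obtain ⟨d, hd⟩ := CombinatorialMap.exists_origin v₀
  have : Nonempty (M.CoverDart v₀) :=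
    ⟨⟨(CombinatorialMap.HomotopyClass.base v₀, d),
      CombinatorialMap.HomotopyClass.endpoint_base.trans hd.symm⟩⟩
  have hv : IsWinding M.next ℓ := isWinding_of_hasCyclicType
    (fun x => M.next.injective.mem_periodicPts x) fun c => ⟨f c, hf c, hfℓ c⟩
  have hfc : IsWinding M.face ℓ := isWinding_of_hasCyclicType
    (fun x => M.face.injective.mem_periodicPts x) fun c => ⟨f' c, hf' c, hfℓ' c⟩
  exact CombinatorialMap.isKConnected_three CombinatorialMap.isAcyclic_universalCover
    CombinatorialMap.isLocallyFinite_universalCover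
    (fun f h => CombinatorialMap.universalCover_eq_of_forall_dart f h)
    (CombinatorialMap.isWinding_universalCover_next hv)
    (CombinatorialMap.isWinding_universalCover_face hfc)
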